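/- **Proposition 2.1.** Let $\Sigma$ be an oriented smooth $n$-manifold without boundary (Hausdorff, second countable) and let $F:\Sigma\to\mathbb R^{n+m}$ be a smooth minimal immersion, i.e. one whose mean curvature vector vanishes. Let $g_{ij}=\langle\partial_iF,\partial_jF\rangle$ be the induced metric, $dv$ its volume measure, $\nabla$ the flat connection of $\mathbb R^{n+m}$, and $(\cdot)^T$, $(\cdot)^N$ the orthogonal projections to the tangent and normal spaces of $\Sigma$. Let $\Omega$ be an exact parallel (i.e. constant-coefficient) $n$-form on $\mathbb R^{n+m}$ and put $$*\Omega=\frac{1}{\sqrt{\det g_{ij}}}\,\Omega\Big(\frac{\partial F}{\partial x^1},\dots,\frac{\partial F}{\partial x^n}\Big)$$ for oriented local coordinates $x^i$. Let $F_s:\Sigma\to\mathbb R^{n+m}$, $0\le s<\varepsilon$ (where $\varepsilon>0$), be a family of immersions, smooth in $(s,p)\in[0,\varepsilon)\times\Sigma$, with $F_0=F$, whose variation field $V=\frac{\partial F_s}{\partial s}\big|_{s=0}$ is normal to $\Sigma$ and has compact support, and suppose that $\nabla_VV=\frac{\partial^2F_s}{\partial s^2}\big|_{s=0}=0$ along $\Sigma$.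 Put $$\|\nabla^NV\|^2=\sum_{i,j}g^{ij}\langle(\nabla_{\partial_i}V)^N,(\nabla_{\partial_j}V)^N\rangle,\qquad B(V,V)=\sum_{i,j,k,l}g^{ik}g^{jl}\Big\langle\frac{\partial^2F}{\partial x^i\partial x^j},V\Big\rangle\Big\langle\frac{\partial^2F}{\partial x^k\partial x^l},V\Big\rangle .$$ At each point of $\Sigma$ let $\partial_1,\dots,\partial_n$ be a positively oriented orthonormal basis of the tangent space (the coordinate vectors at the centre of oriented normal coordinates); it may be chosen arbitrarily from point to point. Then both integrands below are integrable and $$\begin{aligned}\int_\Sigma *\Omega\,\big(\|\nabla^NV\|^2-B(V,V)\big)\,dv=\int_\Sigma\Big[&*\Omega\,\|\nabla^NV\|^2-2\sum_{i<j}\Omega\big(\partial_1,\dots,(\nabla_{\partial_i}V)^T,\dots,(\nabla_{\partial_j}V)^N,\dots,\partial_n\big)\\&-2\sum_{i<j}\Omega\big(\partial_1,\dots,(\nabla_{\partial_i}V)^N,\dots,(\nabla_{\partial_j}V)^N,\dots,\partial_n\big)\\&-2\sum_{i<j}\Omega\big(\partial_1,\dots,(\nabla_{\partial_i}V)^N,\dots,(\nabla_{\partial_j}V)^T,\dots,\partial_n\big)\Big]\,dv,\end{aligned}$$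 where the two displayed vectors stand in the $i$-th and $j$-th places and the remaining places are filled by the $\partial_k$. -/

import Mathlib

open scoped Manifold ContDiff InnerProductSpace

noncomputable section

namespace CalibratedVariation

/-! ### Differential forms on Euclidean space -/

section Forms

variable {d : ℕ}

/-- A differential form on `ℝᵈ` is parallel if its covariant derivative for the flat connection
vanishes everywhere. -/
def IsParallelForm {k : ℕ}
    (Ω : EuclideanSpace ℝ (Fin d) → EuclideanSpace ℝ (Fin d) [⋀^Fin k]→L[ℝ] ℝ) : Prop :=
  ∀ y, HasFDerivAt (𝕜 := ℝ) Ω 0 y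

/-- A differential form on `ℝᵈ` is exact if it is the exterior derivative of a smooth form of
degree one less (there are no nonzero forms of degree `-1`, so an exact `0`-form is zero). -/
def IsExactForm : {k : ℕ} →
    (EuclideanSpace ℝ (Fin d) → EuclideanSpace ℝ (Fin d) [⋀^Fin k]→L[ℝ] ℝ) → Prop
  | 0, Ω => Ω = 0
  | k + 1, Ω => ∃ η : EuclideanSpace ℝ (Fin d) → EuclideanSpace ℝ (Fin d) [⋀^Fin k]→L[ℝ] ℝ,
      ContDiff ℝ ∞ η ∧ extDeriv η = Ω

end Forms

section Geometry

variable {n d : ℕ} {M : Type*} [TopologicalSpace M] [ChartedSpace (EuclideanSpace ℝ (Fin n)) M]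

/-- The atlas of `M` is oriented: every transition map between charts has positive Jacobian
determinant. -/
def OrientedAtlas (n : ℕ) (M : Type*) [TopologicalSpace M]
    [ChartedSpace (EuclideanSpace ℝ (Fin n)) M] : Prop :=
  ∀ c ∈ atlas (EuclideanSpace ℝ (Fin n)) M, ∀ c' ∈ atlas (EuclideanSpace ℝ (Fin n)) M,
    ∀ x ∈ (c.symm.trans c').source,
      0 < (fderiv ℝ (fun y => c' (c.symm y)) x).det

/-- The differential at `p` of a map `M → ℝᵈ`; applied to a vector field `V` along an immersion
and to a tangent vector `w`, it is the flat covariant derivative `∇_w V`. -/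
def D (F : M → EuclideanSpace ℝ (Fin d)) (p : M) :
    TangentSpace (𝓡 n) p →L[ℝ] EuclideanSpace ℝ (Fin d) :=
  mfderiv (𝓡 n) 𝓘(ℝ, EuclideanSpace ℝ (Fin d)) F p

/-- A smooth immersion `M → ℝᵈ`. -/
structure IsSmoothImmersion (n : ℕ) {d : ℕ} {M : Type*} [TopologicalSpace M]
    [ChartedSpace (EuclideanSpace ℝ (Fin n)) M] (F : M → EuclideanSpace ℝ (Fin d)) : Prop where
  smooth : ContMDiff (𝓡 n) 𝓘(ℝ, EuclideanSpace ℝ (Fin d)) ∞ F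
  injective : ∀ p : M, Function.Injective (D (n := n) F p)

/-- The coordinate tangent vectors `∂ᵢ` at `p` of the preferred chart at `p`. -/
def coordVec (p : M) (i : Fin n) : TangentSpace (𝓡 n) p :=
  (EuclideanSpace.single i 1 : EuclideanSpace ℝ (Fin n))

/-- The induced metric `g_{ij} = ⟨∂ᵢF, ∂ⱼF⟩` at `p`, in the preferred chart at `p`. -/
def metric (F : M → EuclideanSpace ℝ (Fin d)) (p : M) : Matrix (Fin n) (Fin n) ℝ :=
  Matrix.of fun i j => ⟪D F p (coordVec p i), D F p (coordVec p j)⟫_ℝ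

/-- The second coordinate derivative `∂²F/∂xⁱ∂xʲ` at `p`, in the preferred chart at `p`. -/
def secondPartial (F : M → EuclideanSpace ℝ (Fin d)) (p : M) (i j : Fin n) :
    EuclideanSpace ℝ (Fin d) :=
  fderiv ℝ (fun y => fderiv ℝ
      (fun z => F ((chartAt (EuclideanSpace ℝ (Fin n)) p).symm z)) y (EuclideanSpace.single j 1))
    (chartAt (EuclideanSpace ℝ (Fin n)) p p) (EuclideanSpace.single i 1)

/-- The tangential part of a vector at `p`: its orthogonal projection to the tangent space
`dF_p(T_pM)`. -/
def tanPart (F : M → EuclideanSpace ℝ (Fin d)) (p : M) (w : EuclideanSpace ℝ (Fin d)) :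
    EuclideanSpace ℝ (Fin d) :=
  (LinearMap.range (D (n := n) F p).toLinearMap).starProjection w

/-- The normal part of a vector at `p`. -/
def norPart (F : M → EuclideanSpace ℝ (Fin d)) (p : M) (w : EuclideanSpace ℝ (Fin d)) :
    EuclideanSpace ℝ (Fin d) :=
  w - tanPart (n := n) F p w

/-- The immersion `F` is minimal: its mean curvature vector `g^{ij} (∂²F/∂xⁱ∂xʲ)^N` vanishes
identically. -/
def IsMinimal (n : ℕ) {d : ℕ} {M : Type*} [TopologicalSpace M]
    [ChartedSpace (EuclideanSpace ℝ (Fin n)) M] (F : M → EuclideanSpace ℝ (Fin d)) : Prop :=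
  ∀ p : M, ∑ i : Fin n, ∑ j : Fin n,
    (metric F p)⁻¹ i j • norPart (n := n) F p (secondPartial F p i j) = 0

/-- `‖∇ᴺV‖² = g^{ij} ⟨(∇_{∂ᵢ}V)^N, (∇_{∂ⱼ}V)^N⟩`. -/
def normSqNormalDeriv (n : ℕ) {d : ℕ} {M : Type*} [TopologicalSpace M]
    [ChartedSpace (EuclideanSpace ℝ (Fin n)) M]
    (F V : M → EuclideanSpace ℝ (Fin d)) (p : M) : ℝ :=
  ∑ i : Fin n, ∑ j : Fin n, (metric F p)⁻¹ i j *
    ⟪norPart (n := n) F p (D V p (coordVec p i)),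
      norPart (n := n) F p (D V p (coordVec p j))⟫_ℝ

/-- `B(V,V) = g^{ik} g^{jl} ⟨∂²F/∂xⁱ∂xʲ, V⟩ ⟨∂²F/∂xᵏ∂xˡ, V⟩`. -/
def B (n : ℕ) {d : ℕ} {M : Type*} [TopologicalSpace M]
    [ChartedSpace (EuclideanSpace ℝ (Fin n)) M]
    (F V : M → EuclideanSpace ℝ (Fin d)) (p : M) : ℝ :=
  ∑ i : Fin n, ∑ j : Fin n, ∑ k : Fin n, ∑ l : Fin n,
    (metric F p)⁻¹ i k * (metric F p)⁻¹ j l *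
      ⟪secondPartial F p i j, V p⟫_ℝ * ⟪secondPartial F p k l, V p⟫_ℝ

/-- `*Ω = (det g)^{-1/2} Ω(∂F/∂x¹, …, ∂F/∂xⁿ)`. -/
def hodgeStar (Ω : EuclideanSpace ℝ (Fin d) → EuclideanSpace ℝ (Fin d) [⋀^Fin n]→L[ℝ] ℝ)
    (F : M → EuclideanSpace ℝ (Fin d)) (p : M) : ℝ :=
  (√(metric (n := n) F p).det)⁻¹ * Ω (F p) (fun i => D F p (coordVec p i))

/-- The Riemannian volume density `√(det g_{ij})` of `F` in the coordinates of a chart `c`. -/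
def volDensity (F : M → EuclideanSpace ℝ (Fin d))
    (c : OpenPartialHomeomorph M (EuclideanSpace ℝ (Fin n))) (x : EuclideanSpace ℝ (Fin n)) : ℝ :=
  √(Matrix.of fun i j : Fin n =>
      ⟪fderiv ℝ (fun y => F (c.symm y)) x (EuclideanSpace.single i 1),
        fderiv ℝ (fun y => F (c.symm y)) x (EuclideanSpace.single j 1)⟫_ℝ).det

/-- The Riemannian volume measure `dv` of the metric induced by `F`: the least measure on `M` that
dominates, for each chart `c` of the atlas, the measure `√(det g_{ij}) dx¹⋯dxⁿ` carried by the
domain of `c`. By the change of variables formula these measures agree on overlaps, so that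
(`M` being covered by countably many charts) this is the measure which is `√(det g_{ij}) dx¹⋯dxⁿ`
in every chart. -/
def riemannianVolume (n : ℕ) {d : ℕ} {M : Type*} [TopologicalSpace M]
    [ChartedSpace (EuclideanSpace ℝ (Fin n)) M] [MeasurableSpace M]
    (F : M → EuclideanSpace ℝ (Fin d)) : MeasureTheory.Measure M :=
  ⨆ c ∈ atlas (EuclideanSpace ℝ (Fin n)) M,
    MeasureTheory.Measure.map c.symm
      ((MeasureTheory.volume.restrict c.target).withDensity
        (fun x => ENNReal.ofReal (volDensity F c x)))

/-- `e` consists of positively oriented bases of the tangent spaces of `M`, orthonormal for the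
metric induced by `F` (at each `p`, the coordinate vectors `∂₁, …, ∂ₙ` at `p` of oriented normal
coordinates centred at `p`). No continuity in `p` is required. -/
structure IsOrientedOrthonormalFrame (F : M → EuclideanSpace ℝ (Fin d))
    (e : ∀ p : M, Fin n → TangentSpace (𝓡 n) p) : Prop where
  orthonormal : ∀ p, Orthonormal ℝ (fun i => D F p (e p i))
  oriented : ∀ p, 0 < (Matrix.of fun i j : Fin n => (show EuclideanSpace ℝ (Fin n) from e p i) j).det

/-- `Φ s`, `0 ≤ s < ε`, is a smooth one-parameter family of immersions starting at `F`, whose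
variation field `V = ∂Φ/∂s` at `s = 0` is normal and has compact support. -/
structure IsNormalVariation (n : ℕ) {d : ℕ} {M : Type*} [TopologicalSpace M]
    [ChartedSpace (EuclideanSpace ℝ (Fin n)) M] (F : M → EuclideanSpace ℝ (Fin d))
    (ε : ℝ) (Φ : ℝ → M → EuclideanSpace ℝ (Fin d)) (V : M → EuclideanSpace ℝ (Fin d)) : Prop where
  pos : 0 < ε
  smooth : ContMDiffOn (𝓘(ℝ, ℝ).prod (𝓡 n)) 𝓘(ℝ, EuclideanSpace ℝ (Fin d)) ∞
    (fun q : ℝ × M => Φ q.1 q.2) (Set.Ico 0 ε ×ˢ Set.univ)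
  immersion : ∀ s ∈ Set.Ico 0 ε, IsSmoothImmersion n (Φ s)
  initial : Φ 0 = F
  field : ∀ p, HasDerivWithinAt (fun s => Φ s p) (V p) (Set.Ico 0 ε) 0
  normal : ∀ (p : M) (w : TangentSpace (𝓡 n) p), ⟪V p, D F p w⟫_ℝ = 0
  compactSupport : HasCompactSupport V

/-- `∑_{i<j} Ω(∂₁, …, a i, …, b j, …, ∂ₙ)`, where `∂ₖ = dF(e k)`, the vector `a i` stands in the
`i`-th place and `b j` in the `j`-th place. -/
def pairSum (Ω : EuclideanSpace ℝ (Fin d) → EuclideanSpace ℝ (Fin d) [⋀^Fin n]→L[ℝ] ℝ)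
    (F : M → EuclideanSpace ℝ (Fin d)) (p : M) (e : Fin n → TangentSpace (𝓡 n) p)
    (a b : Fin n → EuclideanSpace ℝ (Fin d)) : ℝ :=
  ∑ i : Fin n, ∑ j ∈ Finset.Ioi i,
    Ω (F p) (Function.update (Function.update (fun k => D F p (e k)) i (a i)) j (b j))

end Geometry

end CalibratedVariation

end

/-! A parallel form is a constant alternating form `α`. Write `a` for the coordinate derivatives of
`F` and `w` for those of `V`. The second-order coefficient governing `α` on `a + s w` is `mixedSum α
a w w`; in an orthonormal frame it is twice the sum over `i < j` of `α` with `w i` and `w j`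
inserted. Splitting `w` into normal and tangential parts gives four sums, of which the right-hand
integrand contains all but the tangential-tangential one.

That missing sum is algebraic. If `w i` has tangential part `∑ s i j • a j`, the two-slot insertions
yield the 2×2 principal minors of `s`, so twice the sum is `((tr s)² - tr s²) α(a)`. Since `V` is
normal, differentiating `⟨∂ⱼF, V⟩ = 0` shows that `s` is minus the second fundamental form paired
with `V`: it is symmetric, and traceless by minimality. The missing sum is therefore `-*Ω · B(V,V)`,
and the two integrands differ exactly by the normalised `mixedSum` (`integrand_eq`).

It remains to see that this difference integrates to zero. In a chart, `mixedSum` is the divergence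
of the field whose `i`-th component is the sum over `j ≠ i` of `α` on the tuple `∂F` with `V` in
place `i` and `∂ⱼV` in place `j`. Every term with a second derivative cancels, by symmetry of second
derivatives against antisymmetry of `α` (`setIntegral_mixedSum_eq_zero`). A partition of unity
applied to one of the two copies of `V` reduces the global statement to charts
(`integral_mixedDensity_eq_zero`).

Each density is invariant under oriented changes of basis. This yields continuity, hence
integrability, although both the preferred charts and the frame `e` may vary discontinuously from
point to point. -/

noncomputable section

namespace CalibratedVariation

/-! ### Linear combinations of tuples and Gram matrices -/

section LinearAlgebra

variable {n : ℕ} {E : Type*} [NormedAddCommGroup E] [InnerProductSpace ℝ E]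

/-- The tuple of linear combinations of `a` with coefficients the rows of `P`. -/
def comb (P : Matrix (Fin n) (Fin n) ℝ) (a : Fin n → E) : Fin n → E :=
  fun i => ∑ j, P i j • a j

/-- The matrix of inner products of two tuples. -/
def gramMat (a b : Fin n → E) : Matrix (Fin n) (Fin n) ℝ :=
  Matrix.of fun i j => ⟪a i, b j⟫_ℝ

lemma comb_add (P : Matrix (Fin n) (Fin n) ℝ) (a b : Fin n → E) :
    comb P (a + b) = comb P a + comb P b := by
  ext i; simp [comb, Finset.sum_add_distrib]

lemma comb_smul (P : Matrix (Fin n) (Fin n) ℝ) (t : ℝ) (a : Fin n → E) :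
    comb P (t • a) = t • comb P a := by
  ext i; simp [comb, Finset.smul_sum, smul_comm t]

lemma gramMat_comb (P Q : Matrix (Fin n) (Fin n) ℝ) (a b : Fin n → E) :
    gramMat (comb P a) (comb Q b) = P * gramMat a b * Q.transpose := by
  ext i j
  simp only [gramMat, comb, Matrix.of_apply, Matrix.mul_apply, Matrix.transpose_apply, sum_inner,
    inner_sum, inner_smul_left, inner_smul_right, Finset.sum_mul, RCLike.conj_to_real]
  refine Finset.sum_congr rfl fun x _ => ?_
  rw [Finset.mul_sum]
  exact Finset.sum_congr rfl fun y _ => by ring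

lemma comb_comb (P Q : Matrix (Fin n) (Fin n) ℝ) (a : Fin n → E) :
    comb P (comb Q a) = comb (P * Q) a := by
  ext i
  simp only [comb, Matrix.mul_apply, Finset.smul_sum, Finset.sum_smul, smul_smul]
  exact Finset.sum_comm

lemma one_comb (a : Fin n → E) : comb (1 : Matrix (Fin n) (Fin n) ℝ) a = a := by
  ext i; simp [comb, Matrix.one_apply]

lemma gramMat_transpose (a b : Fin n → E) : (gramMat a b).transpose = gramMat b a := by
  ext i j; simp [gramMat, real_inner_comm]

lemma det_gramMat_pos {a : Fin n → E} (ha : LinearIndependent ℝ a) : 0 < (gramMat a a).det :=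
  (Matrix.posDef_gram_of_linearIndependent (𝕜 := ℝ) ha).det_pos

/-- Pulled back along `ℝⁿ → E`, `eⱼ ↦ a j`, the form has top degree and so is a multiple of the
determinant. No independence of `a` is needed. -/
lemma alternating_comb (α : E [⋀^Fin n]→L[ℝ] ℝ) (P : Matrix (Fin n) (Fin n) ℝ) (a : Fin n → E) :
    α (comb P a) = P.det * α a := by
  let L : (Fin n → ℝ) →ₗ[ℝ] E := Fintype.linearCombination ℝ a
  have h := (α.toAlternatingMap.compLinearMap L).eq_smul_basis_det (Pi.basisFun ℝ (Fin n))
  have h2 : α (fun i => L (P i)) =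
      α (fun i => L (Pi.basisFun ℝ (Fin n) i)) * (Pi.basisFun ℝ (Fin n)).det P :=
    congrArg (fun f => f fun i => P i) h
  have e1 : (fun i => L (P i)) = comb P a := by
    ext i; simp [L, comb, Fintype.linearCombination_apply]
  have e2 : (fun i => L (Pi.basisFun ℝ (Fin n) i)) = a := by
    ext i; simp [L]
  rw [e1, e2, Pi.basisFun_det, mul_comm] at h2
  exact h2

/-! ### First and second derivatives of an alternating form along tuples -/

/-- The derivative of an alternating form at `a` in the direction `w`. -/
def linSum (α : E [⋀^Fin n]→L[ℝ] ℝ) (a w : Fin n → E) : ℝ :=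
  ∑ i, α (Function.update a i (w i))

/-- The second derivative of an alternating form at `a` in the directions `w₁` and `w₂`. -/
def mixedSum (α : E [⋀^Fin n]→L[ℝ] ℝ) (a w₁ w₂ : Fin n → E) : ℝ :=
  ∑ i, ∑ j, if i = j then 0 else
    α (Function.update (Function.update a i (w₁ i)) j (w₂ j))

lemma hasDerivAt_alternating_line (α : E [⋀^Fin n]→L[ℝ] ℝ) (a w : Fin n → E) :
    HasDerivAt (fun t : ℝ => α (a + t • w)) (linSum α a w) 0 := by
  have h1 : HasDerivAt (fun t : ℝ => a + t • w) w 0 := by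
    simpa using ((hasDerivAt_id (0 : ℝ)).smul_const w).const_add a
  have h2 := (α.hasFDerivAt (a + (0 : ℝ) • w)).comp_hasDerivAt (0 : ℝ) h1
  convert! h2 using 1
  simp [linSum]

/-- Differentiate the determinant rule `alternating_comb` along `a + t w` and use uniqueness of
derivatives, which avoids expanding the sums. -/
lemma linSum_comb (α : E [⋀^Fin n]→L[ℝ] ℝ) (P : Matrix (Fin n) (Fin n) ℝ) (a w : Fin n → E) :
    linSum α (comb P a) (comb P w) = P.det * linSum α a w := by
  have h1 := hasDerivAt_alternating_line α (comb P a) (comb P w)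
  have h2 := (hasDerivAt_alternating_line α a w).const_mul P.det
  refine h1.unique ?_
  convert! h2 using 2 with t
  rw [← comb_smul, ← comb_add, alternating_comb]

lemma hasDerivAt_linSum_line (α : E [⋀^Fin n]→L[ℝ] ℝ) (a w₁ w₂ : Fin n → E) :
    HasDerivAt (fun t : ℝ => linSum α (a + t • w₂) w₁) (mixedSum α a w₁ w₂) 0 := by
  unfold linSum mixedSum
  refine HasDerivAt.fun_sum fun i _ => ?_
  -- Place `i` is already occupied by `w₁ i` and does not move with `t`, hence the direction `0`
  -- there; this is what makes the diagonal terms of `mixedSum` zero.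
  have h := hasDerivAt_alternating_line α (Function.update a i (w₁ i)) (Function.update w₂ i 0)
  convert! h using 2 with t
  · congr 1
    ext k
    by_cases hk : k = i
    · subst hk; simp
    · simp [hk]
  · unfold linSum
    refine Finset.sum_congr rfl fun j _ => ?_
    by_cases hij : i = j
    · subst hij
      simp only [if_true, Function.update_self]
      exact (α.map_coord_zero i (by simp)).symm
    · simp [hij, Ne.symm hij]

lemma mixedSum_comb (α : E [⋀^Fin n]→L[ℝ] ℝ) (P : Matrix (Fin n) (Fin n) ℝ)
    (a w₁ w₂ : Fin n → E) :
    mixedSum α (comb P a) (comb P w₁) (comb P w₂) = P.det * mixedSum α a w₁ w₂ := by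
  have h1 := hasDerivAt_linSum_line α (comb P a) (comb P w₁) (comb P w₂)
  have h2 := (hasDerivAt_linSum_line α a w₁ w₂).const_mul P.det
  refine h1.unique ?_
  convert! h2 using 2 with t
  rw [← comb_smul, ← comb_add, linSum_comb]

/-- Additivity in one direction alone is what lets a partition of unity act on one copy of the
variation field. -/
lemma mixedSum_sum_left {ι : Type*} (s : Finset ι) (α : E [⋀^Fin n]→L[ℝ] ℝ) (a : Fin n → E)
    (w₁ : ι → Fin n → E) (w₂ : Fin n → E) :
    mixedSum α a (fun i => ∑ k ∈ s, w₁ k i) w₂ = ∑ k ∈ s, mixedSum α a (w₁ k) w₂ := by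
  unfold mixedSum
  rw [Finset.sum_comm (s := s)]
  refine Finset.sum_congr rfl fun i _ => ?_
  rw [Finset.sum_comm (s := s)]
  refine Finset.sum_congr rfl fun j _ => ?_
  by_cases hij : i = j
  · simp [hij]
  · simp only [hij, if_false]
    simp_rw [Function.update_comm hij]
    exact α.toMultilinearMap.map_update_sum s i (fun k => w₁ k i) _

/-! ### Sums over pairs of places, and principal minors -/

/-- The sum over `i < j` in an alternating form, with `x i` in the `i`-th and `y j` in the `j`-th
place. -/
def ltSum (α : E [⋀^Fin n]→L[ℝ] ℝ) (a x y : Fin n → E) : ℝ :=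
  ∑ i : Fin n, ∑ j ∈ Finset.Ioi i, α (Function.update (Function.update a i (x i)) j (y j))

lemma sum_offdiag_eq_of_symm (f : Fin n → Fin n → ℝ) (hf : ∀ i j, f i j = f j i) :
    ∑ i, ∑ j, (if i = j then 0 else f i j) = 2 * ∑ i, ∑ j ∈ Finset.Ioi i, f i j := by
  have h1 : ∀ i, ∑ j ∈ Finset.Ioi i, f i j = ∑ j, if i < j then f i j else 0 := by
    intro i
    rw [← Finset.sum_filter]
    congr 1
    ext j; simp
  simp_rw [h1]
  have h2 : ∑ i, ∑ j, (if i < j then f i j else 0) = ∑ i, ∑ j, (if j < i then f i j else 0) := by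
    rw [Finset.sum_comm]
    refine Finset.sum_congr rfl fun i _ => Finset.sum_congr rfl fun j _ => ?_
    rw [hf]
  rw [two_mul]
  nth_rewrite 2 [h2]
  simp_rw [← Finset.sum_add_distrib]
  refine Finset.sum_congr rfl fun i _ => Finset.sum_congr rfl fun j _ => ?_
  rcases lt_trichotomy i j with h | h | h
  · simp [h, h.ne, h.not_gt]
  · simp [h]
  · simp [h, h.ne', h.not_gt]

lemma mixedSum_self (α : E [⋀^Fin n]→L[ℝ] ℝ) (a w : Fin n → E) :
    mixedSum α a w w = 2 * ltSum α a w w := by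
  have := sum_offdiag_eq_of_symm
    (fun i j => if i = j then 0 else α (Function.update (Function.update a i (w i)) j (w j))) (by
      intro i j
      by_cases hij : i = j
      · simp [hij]
      · simp only [hij, Ne.symm hij, if_false]
        rw [Function.update_comm hij])
  unfold mixedSum ltSum
  convert this using 1
  · refine Finset.sum_congr rfl fun i _ => Finset.sum_congr rfl fun j _ => ?_
    split_ifs <;> rfl
  · congr 1
    refine Finset.sum_congr rfl fun i _ => Finset.sum_congr rfl fun j hj => ?_
    rw [if_neg (Finset.mem_Ioi.1 hj).ne]

lemma ltSum_add (α : E [⋀^Fin n]→L[ℝ] ℝ) (a x y : Fin n → E) :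
    ltSum α a (x + y) (x + y) = ltSum α a x x + ltSum α a x y + ltSum α a y x + ltSum α a y y := by
  unfold ltSum
  simp_rw [← Finset.sum_add_distrib]
  refine Finset.sum_congr rfl fun i _ => Finset.sum_congr rfl fun j hj => ?_
  have hij : i ≠ j := (Finset.mem_Ioi.1 hj).ne
  simp only [Pi.add_apply, ContinuousAlternatingMap.map_update_add]
  have h : ∀ v, α (Function.update (Function.update a i (x i + y i)) j v) =
      α (Function.update (Function.update a i (x i)) j v) +
        α (Function.update (Function.update a i (y i)) j v) := by
    intro v
    simp only [Function.update_comm hij, ContinuousAlternatingMap.map_update_add]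
  rw [h, h]
  ring

/-- Expanding the combinations, any `a k` with `k ≠ i, j` repeats an entry already present. Only `(a
i, a j)` and its swap `(a j, a i)` survive, giving a 2×2 minor of `s`. -/
lemma alternating_update_update_comb (α : E [⋀^Fin n]→L[ℝ] ℝ) (a : Fin n → E)
    (s : Matrix (Fin n) (Fin n) ℝ) {i j : Fin n} (hij : i ≠ j) :
    α (Function.update (Function.update a i (comb s a i)) j (comb s a j)) =
      (s i i * s j j - s i j * s j i) * α a := by
  have hv : ∀ v : E, α (Function.update (Function.update a i (comb s a i)) j v) =
      ∑ k, s i k * α (Function.update (Function.update a i (a k)) j v) := by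
    intro v
    rw [Function.update_comm hij]
    refine (α.toMultilinearMap.map_update_sum Finset.univ i (fun k => s i k • a k) _).trans ?_
    refine Finset.sum_congr rfl fun k _ => ?_
    rw [Function.update_comm hij]
    exact α.map_update_smul _ i (s i k) (a k)
  have hw : ∀ b : Fin n → E, α (Function.update b j (comb s a j)) =
      ∑ l, s j l * α (Function.update b j (a l)) := by
    intro b
    refine (α.toMultilinearMap.map_update_sum Finset.univ j (fun k => s j k • a k) _).trans ?_
    exact Finset.sum_congr rfl fun k _ => α.map_update_smul _ j (s j k) (a k)
  have h1 : ∑ k, s i k * α (Function.update (Function.update a i (a k)) j (comb s a j)) =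
      s i i * α (Function.update a j (comb s a j)) +
        s i j * α (Function.update (Function.update a i (a j)) j (comb s a j)) := by
    rw [Finset.sum_eq_add i j hij]
    · simp
    · rintro k - ⟨hki, hkj⟩
      rw [α.map_eq_zero_of_eq _ (i := i) (j := k) (by simp [hij, hki, hkj]) (Ne.symm hki), mul_zero]
    · simp
    · simp
  have h2 : α (Function.update a j (comb s a j)) = s j j * α a := by
    rw [hw, Finset.sum_eq_single j]
    · simp
    · intro k _ hkj
      rw [α.map_eq_zero_of_eq _ (i := j) (j := k) (by simp [hkj]) (Ne.symm hkj), mul_zero]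
    · simp
  have h3 : α (Function.update (Function.update a i (a j)) j (comb s a j)) = - (s j i * α a) := by
    rw [hw, Finset.sum_eq_single i]
    · have e : Function.update (Function.update a i (a j)) j (a i) = a ∘ Equiv.swap i j := by
        ext k
        by_cases hkj : k = j
        · subst hkj; simp
        · by_cases hki : k = i
          · subst hki; simp [hkj]
          · simp [hkj, hki, Equiv.swap_apply_of_ne_of_ne]
      have hs : α (a ∘ Equiv.swap i j) = -α a := α.toAlternatingMap.map_swap a hij
      rw [e, hs, mul_neg]
    · intro k _ hki
      by_cases hkj : k = j
      · subst hkj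
        rw [α.map_eq_zero_of_eq _ (i := i) (j := k) (by simp [hij]) hij, mul_zero]
      · rw [α.map_eq_zero_of_eq _ (i := j) (j := k) (by simp [hki, hkj]) (Ne.symm hkj), mul_zero]
    · simp
  rw [hv, h1, h2, h3]
  ring

/-- The sum of the 2×2 principal minors is the second elementary symmetric function of the
eigenvalues. The minor formula vanishes for `i = j`, so the off-diagonal sum may be taken over all
pairs. -/
lemma two_mul_ltSum_comb (α : E [⋀^Fin n]→L[ℝ] ℝ) (a : Fin n → E)
    (s : Matrix (Fin n) (Fin n) ℝ) :
    2 * ltSum α a (comb s a) (comb s a) = (s.trace ^ 2 - (s * s).trace) * α a := by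
  rw [← mixedSum_self]
  have : mixedSum α a (comb s a) (comb s a) =
      ∑ i, ∑ j, (s i i * s j j - s i j * s j i) * α a := by
    refine Finset.sum_congr rfl fun i _ => Finset.sum_congr rfl fun j _ => ?_
    by_cases hij : i = j
    · subst hij; simp
    · rw [if_neg hij, alternating_update_update_comb α a s hij]
  rw [this]
  simp_rw [← Finset.sum_mul, Finset.sum_sub_distrib, sq, Matrix.trace, Finset.sum_mul_sum,
    Matrix.diag_apply, Matrix.mul_apply]

/-! ### Densities invariant under change of basis -/

/-- The trace of `S S'` with both indices raised by the metric of `a`. -/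
def doubleTrace (a : Fin n → E) (S S' : Matrix (Fin n) (Fin n) ℝ) : ℝ :=
  ((gramMat a a)⁻¹ * S * (gramMat a a)⁻¹ * S'.transpose).trace

lemma inv_conj (P G : Matrix (Fin n) (Fin n) ℝ) :
    (P * G * P.transpose)⁻¹ = P.transpose⁻¹ * G⁻¹ * P⁻¹ := by
  rw [Matrix.mul_inv_rev, Matrix.mul_inv_rev, Matrix.mul_assoc]

/-- The inverse metric transforms contragrediently to `S`, so the factors of `P` cancel by cyclicity
of the trace. -/
lemma trace_inv_gramMat_comb {P : Matrix (Fin n) (Fin n) ℝ} (hP : P.det ≠ 0) (a : Fin n → E)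
    (S : Matrix (Fin n) (Fin n) ℝ) :
    ((gramMat (comb P a) (comb P a))⁻¹ * (P * S * P.transpose)).trace =
      ((gramMat a a)⁻¹ * S).trace := by
  have hu : IsUnit P.det := hP.isUnit
  have hu' : IsUnit P.transpose.det := by rwa [Matrix.det_transpose]
  rw [gramMat_comb, inv_conj]
  have : P.transpose⁻¹ * (gramMat a a)⁻¹ * P⁻¹ * (P * S * P.transpose) =
      P.transpose⁻¹ * ((gramMat a a)⁻¹ * S * P.transpose) := by
    simp only [Matrix.mul_assoc, Matrix.nonsing_inv_mul_cancel_left _ _ hu]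
  rw [this, Matrix.trace_mul_comm, Matrix.mul_assoc, Matrix.mul_nonsing_inv _ hu', Matrix.mul_one]

lemma doubleTrace_comb {P : Matrix (Fin n) (Fin n) ℝ} (hP : P.det ≠ 0) (a : Fin n → E)
    (S S' : Matrix (Fin n) (Fin n) ℝ) :
    doubleTrace (comb P a) (P * S * P.transpose) (P * S' * P.transpose) = doubleTrace a S S' := by
  have hu : IsUnit P.det := hP.isUnit
  have hu' : IsUnit P.transpose.det := by rwa [Matrix.det_transpose]
  have := trace_inv_gramMat_comb hP a (S * (gramMat a a)⁻¹ * S'.transpose)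
  unfold doubleTrace
  rw [Matrix.mul_assoc (gramMat a a)⁻¹, Matrix.mul_assoc (gramMat a a)⁻¹, ← this]
  rw [Matrix.mul_assoc, Matrix.mul_assoc]
  congr 2
  rw [gramMat_comb, inv_conj]
  simp only [Matrix.mul_assoc, Matrix.transpose_mul, Matrix.transpose_transpose,
    Matrix.nonsing_inv_mul_cancel_left _ _ hu, Matrix.mul_nonsing_inv_cancel_left _ _ hu']

/-- The density `g^{ij}⟨(wᵢ)^N, (wⱼ)^N⟩` in terms of inner products. -/
def normalEnergy (a w : Fin n → E) : ℝ :=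
  ((gramMat a a)⁻¹ * gramMat w w).trace - doubleTrace a (gramMat w a) (gramMat w a)

/-- The density `g^{ik} g^{jl} ⟨wᵢ, aⱼ⟩ ⟨wₖ, aₗ⟩`. -/
def tangentEnergy (a w : Fin n → E) : ℝ := doubleTrace a (gramMat w a) (gramMat w a)

lemma normalEnergy_comb {P : Matrix (Fin n) (Fin n) ℝ} (hP : P.det ≠ 0) (a w : Fin n → E) :
    normalEnergy (comb P a) (comb P w) = normalEnergy a w := by
  unfold normalEnergy
  rw [gramMat_comb _ _ w w, gramMat_comb _ _ w a, doubleTrace_comb hP, trace_inv_gramMat_comb hP]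

lemma tangentEnergy_comb {P : Matrix (Fin n) (Fin n) ℝ} (hP : P.det ≠ 0) (a w : Fin n → E) :
    tangentEnergy (comb P a) (comb P w) = tangentEnergy a w := by
  unfold tangentEnergy
  rw [gramMat_comb _ _ w a, doubleTrace_comb hP]

lemma sqrt_det_gramMat_comb {P : Matrix (Fin n) (Fin n) ℝ} (a : Fin n → E) :
    √(gramMat (comb P a) (comb P a)).det = |P.det| * √(gramMat a a).det := by
  rw [gramMat_comb, Matrix.det_mul, Matrix.det_mul, Matrix.det_transpose,
    show P.det * (gramMat a a).det * P.det = P.det ^ 2 * (gramMat a a).det by ring,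
    Real.sqrt_mul (sq_nonneg _), Real.sqrt_sq_eq_abs]

/-- The second derivative `mixedSum` of `α`, normalised by the volume of `a`. -/
def mixedDensity (α : E [⋀^Fin n]→L[ℝ] ℝ) (a w₁ w₂ : Fin n → E) : ℝ :=
  (√(gramMat a a).det)⁻¹ * mixedSum α a w₁ w₂

lemma mixedDensity_comb (α : E [⋀^Fin n]→L[ℝ] ℝ) {P : Matrix (Fin n) (Fin n) ℝ} (hP : 0 < P.det)
    (a w₁ w₂ : Fin n → E) :
    mixedDensity α (comb P a) (comb P w₁) (comb P w₂) = mixedDensity α a w₁ w₂ := by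
  unfold mixedDensity
  rw [sqrt_det_gramMat_comb, mixedSum_comb, abs_of_pos hP]
  field_simp

/-- The value of `α` on the unit volume element of `a`. -/
def unitValue (α : E [⋀^Fin n]→L[ℝ] ℝ) (a : Fin n → E) : ℝ := (√(gramMat a a).det)⁻¹ * α a

lemma unitValue_comb (α : E [⋀^Fin n]→L[ℝ] ℝ) {P : Matrix (Fin n) (Fin n) ℝ} (hP : 0 < P.det)
    (a : Fin n → E) : unitValue α (comb P a) = unitValue α a := by
  unfold unitValue
  rw [sqrt_det_gramMat_comb, alternating_comb, abs_of_pos hP]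
  field_simp

/-- For an orthonormal tuple `a`, and `w` whose tangential part `comb s a` is given by a symmetric
traceless matrix `s`, the tangential energy is recovered from `ltSum`. -/
lemma two_mul_ltSum_tangential (α : E [⋀^Fin n]→L[ℝ] ℝ) {a w : Fin n → E}
    (ha : gramMat a a = 1) (hsym : (gramMat w a).transpose = gramMat w a)
    (htr : (gramMat w a).trace = 0) :
    2 * ltSum α a (comb (gramMat w a) a) (comb (gramMat w a) a) =
      - (unitValue α a * tangentEnergy a w) := by
  rw [two_mul_ltSum_comb, htr, unitValue, tangentEnergy, doubleTrace, ha, hsym]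
  simp
  ring

lemma gramMat_add_comb {a ν : Fin n → E} (h : gramMat ν a = 0) (P : Matrix (Fin n) (Fin n) ℝ) :
    gramMat (ν + comb P a) a = P * gramMat a a := by
  have h1 : gramMat (comb P a) a = P * gramMat a a := by
    ext i j
    simp [gramMat, comb, Matrix.mul_apply, sum_inner, inner_smul_left]
  rw [← h1]
  ext i j
  have := congrFun (congrFun h i) j
  simp only [gramMat, Matrix.of_apply, Matrix.zero_apply] at this
  simp [gramMat, inner_add_left, this]

/-- Orthogonality removes the cross terms, and the energy of `comb P a` is exactly the subtracted
double trace. Thus `normalEnergy` computes the energy of the normal part without projections, which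
makes its continuity and invariance easy to see. -/
lemma normalEnergy_add_comb {a ν : Fin n → E} (ha : LinearIndependent ℝ a)
    (h : gramMat ν a = 0) (P : Matrix (Fin n) (Fin n) ℝ) :
    normalEnergy a (ν + comb P a) = ((gramMat a a)⁻¹ * gramMat ν ν).trace := by
  have hu : IsUnit (gramMat a a).det := (det_gramMat_pos ha).ne'.isUnit
  have h1 : gramMat ν (comb P a) = 0 := by
    have := gramMat_comb 1 P ν a
    rw [one_comb, h] at this
    simpa using this
  have h2 : gramMat (comb P a) ν = 0 := by
    rw [← gramMat_transpose, h1, Matrix.transpose_zero]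
  have h3 : gramMat (ν + comb P a) (ν + comb P a) =
      gramMat ν ν + gramMat ν (comb P a) + (gramMat (comb P a) ν + gramMat (comb P a) (comb P a)) := by
    ext i j
    simp [gramMat, inner_add_left, inner_add_right]
    ring
  unfold normalEnergy doubleTrace
  rw [gramMat_add_comb h, h3, h1, h2, gramMat_comb, Matrix.transpose_mul, gramMat_transpose]
  simp only [Matrix.mul_assoc, Matrix.nonsing_inv_mul_cancel_left _ _ hu, add_zero, zero_add,
    Matrix.mul_add, Matrix.trace_add]
  ring

/-! ### Continuity of the densities at independent tuples -/

lemma continuousAt_inv_matrix {M₀ : Matrix (Fin n) (Fin n) ℝ} (h : M₀.det ≠ 0) :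
    ContinuousAt (fun M : Matrix (Fin n) (Fin n) ℝ => M⁻¹) M₀ := by
  simp_rw [Matrix.inv_def, Ring.inverse_eq_inv]
  exact ((continuous_id.matrix_det.continuousAt).inv₀ h).smul
    continuous_id.matrix_adjugate.continuousAt

lemma continuous_gramMat : Continuous fun p : (Fin n → E) × (Fin n → E) => gramMat p.1 p.2 :=
  continuous_matrix fun i j => by
    simp only [gramMat, Matrix.of_apply]; fun_prop

lemma continuousAt_inv_gramMat {X : Type*} [TopologicalSpace X] {x : X} {a : X → Fin n → E}
    (ha : ContinuousAt a x) (hx : LinearIndependent ℝ (a x)) :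
    ContinuousAt (fun y => (gramMat (a y) (a y))⁻¹) x := by
  have h : ContinuousAt (fun y => gramMat (a y) (a y)) x :=
    continuous_gramMat.continuousAt.comp (f := fun y => (a y, a y)) (ha.prodMk ha)
  exact (continuousAt_inv_matrix (det_gramMat_pos hx).ne').comp
    (f := fun y => gramMat (a y) (a y)) h

lemma continuousAt_sqrt_det_inv {X : Type*} [TopologicalSpace X] {x : X} {a : X → Fin n → E}
    (ha : ContinuousAt a x) (hx : LinearIndependent ℝ (a x)) :
    ContinuousAt (fun y => (√(gramMat (a y) (a y)).det)⁻¹) x := by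
  have h : ContinuousAt (fun y => gramMat (a y) (a y)) x :=
    continuous_gramMat.continuousAt.comp (f := fun y => (a y, a y)) (ha.prodMk ha)
  have h2 : ContinuousAt (fun y => (gramMat (a y) (a y)).det) x :=
    continuous_id.matrix_det.continuousAt.comp (f := fun y => gramMat (a y) (a y)) h
  exact (h2.sqrt).inv₀ (Real.sqrt_pos.2 (det_gramMat_pos hx)).ne'

lemma continuousAt_unitValue {X : Type*} [TopologicalSpace X] {x : X} {a : X → Fin n → E}
    (α : E [⋀^Fin n]→L[ℝ] ℝ) (ha : ContinuousAt a x) (hx : LinearIndependent ℝ (a x)) :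
    ContinuousAt (fun y => unitValue α (a y)) x :=
  (continuousAt_sqrt_det_inv ha hx).mul (α.cont.continuousAt.comp ha)

lemma continuous_mixedSum (α : E [⋀^Fin n]→L[ℝ] ℝ) :
    Continuous fun p : (Fin n → E) × (Fin n → E) × (Fin n → E) =>
      mixedSum α p.1 p.2.1 p.2.2 := by
  unfold mixedSum
  refine continuous_finsetSum _ fun i _ => continuous_finsetSum _ fun j _ => ?_
  split_ifs
  · exact continuous_const
  · refine α.cont.comp ?_
    refine (continuous_fst.update i ?_).update j ?_ <;> fun_prop

lemma continuousAt_mixedDensity {X : Type*} [TopologicalSpace X] {x : X} {a w₁ w₂ : X → Fin n → E}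
    (α : E [⋀^Fin n]→L[ℝ] ℝ) (ha : ContinuousAt a x) (hx : LinearIndependent ℝ (a x))
    (h₁ : ContinuousAt w₁ x) (h₂ : ContinuousAt w₂ x) :
    ContinuousAt (fun y => mixedDensity α (a y) (w₁ y) (w₂ y)) x :=
  (continuousAt_sqrt_det_inv ha hx).mul ((continuous_mixedSum α).continuousAt.comp
    (f := fun y => (a y, w₁ y, w₂ y)) (ha.prodMk (h₁.prodMk h₂)))

lemma continuousAt_tangentEnergy {X : Type*} [TopologicalSpace X] {x : X} {a w : X → Fin n → E}
    (ha : ContinuousAt a x) (hx : LinearIndependent ℝ (a x)) (hw : ContinuousAt w x) :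
    ContinuousAt (fun y => tangentEnergy (a y) (w y)) x := by
  have hi := continuousAt_inv_gramMat ha hx
  have h : ContinuousAt (fun y => gramMat (w y) (a y)) x :=
    continuous_gramMat.continuousAt.comp (f := fun y => (w y, a y)) (hw.prodMk ha)
  have hc : Continuous fun p : Matrix (Fin n) (Fin n) ℝ × Matrix (Fin n) (Fin n) ℝ =>
      (p.1 * p.2 * p.1 * p.2.transpose).trace := by fun_prop
  exact hc.continuousAt.comp (f := fun y => ((gramMat (a y) (a y))⁻¹, gramMat (w y) (a y)))
    (hi.prodMk h)

lemma continuousAt_normalEnergy {X : Type*} [TopologicalSpace X] {x : X} {a w : X → Fin n → E}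
    (ha : ContinuousAt a x) (hx : LinearIndependent ℝ (a x)) (hw : ContinuousAt w x) :
    ContinuousAt (fun y => normalEnergy (a y) (w y)) x := by
  have hi := continuousAt_inv_gramMat ha hx
  have h : ContinuousAt (fun y => gramMat (w y) (w y)) x :=
    continuous_gramMat.continuousAt.comp (f := fun y => (w y, w y)) (hw.prodMk hw)
  have hc : Continuous fun p : Matrix (Fin n) (Fin n) ℝ × Matrix (Fin n) (Fin n) ℝ =>
      (p.1 * p.2).trace := by fun_prop
  exact (hc.continuousAt.comp (f := fun y => ((gramMat (a y) (a y))⁻¹, gramMat (w y) (w y)))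
    (hi.prodMk h)).sub (continuousAt_tangentEnergy ha hx hw)

end LinearAlgebra

/-! ### Coordinate frames and their change between charts -/

section Charts

/-- The Jacobian matrix (with the derivatives as rows) of the transition from `c` to `c'`. -/
def jac {n : ℕ} {M : Type*} [TopologicalSpace M]
    (c c' : OpenPartialHomeomorph M (EuclideanSpace ℝ (Fin n)))
    (x : EuclideanSpace ℝ (Fin n)) : Matrix (Fin n) (Fin n) ℝ :=
  Matrix.of fun i j => (fderiv ℝ (fun y => c' (c.symm y)) x (EuclideanSpace.single i 1)) j

lemma det_jac {n : ℕ} {M : Type*} [TopologicalSpace M]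
    (c c' : OpenPartialHomeomorph M (EuclideanSpace ℝ (Fin n)))
    (x : EuclideanSpace ℝ (Fin n)) :
    (jac c c' x).det = (fderiv ℝ (fun y => c' (c.symm y)) x).det := by
  rw [ContinuousLinearMap.det,
    ← LinearMap.det_toMatrix (EuclideanSpace.basisFun (Fin n) ℝ).toBasis, ← Matrix.det_transpose]
  congr 1

variable {n d : ℕ} {M : Type*} [TopologicalSpace M] [ChartedSpace (EuclideanSpace ℝ (Fin n)) M]

/-- The images under the differential of `G` of the coordinate vectors at `p`. -/
def coordFrame (n : ℕ) {d : ℕ} {M : Type*} [TopologicalSpace M]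
    [ChartedSpace (EuclideanSpace ℝ (Fin n)) M] (G : M → EuclideanSpace ℝ (Fin d)) (p : M) :
    Fin n → EuclideanSpace ℝ (Fin d) :=
  fun i => D G p (coordVec p i)

/-- The coordinate derivatives of `G` in the chart `c`. -/
def chartFrame (G : M → EuclideanSpace ℝ (Fin d))
    (c : OpenPartialHomeomorph M (EuclideanSpace ℝ (Fin n))) (x : EuclideanSpace ℝ (Fin n)) :
    Fin n → EuclideanSpace ℝ (Fin d) :=
  fun i => fderiv ℝ (fun y => G (c.symm y)) x (EuclideanSpace.single i 1)

lemma euclidean_eq_sum_single (v : EuclideanSpace ℝ (Fin n)) :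
    v = ∑ j, v j • EuclideanSpace.single j (1 : ℝ) := by
  ext k
  simp [Finset.sum_apply, Pi.single_apply]

lemma D_eq_comb (G : M → EuclideanSpace ℝ (Fin d)) (p : M) (e : Fin n → TangentSpace (𝓡 n) p) :
    (fun i => D G p (e i)) =
      comb (Matrix.of fun i j : Fin n => (show EuclideanSpace ℝ (Fin n) from e i) j)
        (coordFrame n G p) := by
  ext1 i
  have h : e i = ∑ j, (show EuclideanSpace ℝ (Fin n) from e i) j • coordVec p j :=
    euclidean_eq_sum_single (show EuclideanSpace ℝ (Fin n) from e i)
  simp only [comb, coordFrame, Matrix.of_apply]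
  conv_lhs => rw [h]
  rw [map_sum]
  exact Finset.sum_congr rfl fun j _ => map_smul _ _ _

lemma linearIndependent_coordFrame {F : M → EuclideanSpace ℝ (Fin d)} {p : M}
    (h : Function.Injective (D (n := n) F p)) : LinearIndependent ℝ (coordFrame n F p) := by
  have hb : LinearIndependent ℝ fun i : Fin n => (EuclideanSpace.single i 1 : EuclideanSpace ℝ (Fin n)) := by
    have := (EuclideanSpace.basisFun (Fin n) ℝ).orthonormal.linearIndependent
    convert! this using 2 with i
    simp
  exact hb.map' (D (n := n) F p).toLinearMap (LinearMap.ker_eq_bot.2 h)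

lemma D_eq_fderiv {G : M → EuclideanSpace ℝ (Fin d)} {p : M}
    (hG : MDifferentiableAt (𝓡 n) 𝓘(ℝ, EuclideanSpace ℝ (Fin d)) G p)
    (v : EuclideanSpace ℝ (Fin n)) :
    D G p v = fderiv ℝ (fun y => G ((chartAt (EuclideanSpace ℝ (Fin n)) p).symm y))
      (chartAt (EuclideanSpace ℝ (Fin n)) p p) v := by
  have h : D G p = fderivWithin ℝ (writtenInExtChartAt (𝓡 n) 𝓘(ℝ, EuclideanSpace ℝ (Fin d)) p G)
      (Set.range (𝓡 n)) (extChartAt (𝓡 n) p p) := hG.mfderiv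
  have h2 : D G p = fderiv ℝ (fun y => G ((chartAt (EuclideanSpace ℝ (Fin n)) p).symm y))
      (chartAt (EuclideanSpace ℝ (Fin n)) p p) := by
    rw [h]
    simp [writtenInExtChartAt, Function.comp_def, fderivWithin_univ]
    rfl
  exact congrArg (fun f : EuclideanSpace ℝ (Fin n) →L[ℝ] EuclideanSpace ℝ (Fin d) => f v) h2

lemma coordFrame_eq_chartFrame {G : M → EuclideanSpace ℝ (Fin d)}
    (hG : ContMDiff (𝓡 n) 𝓘(ℝ, EuclideanSpace ℝ (Fin d)) ∞ G) (p : M) :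
    coordFrame n G p = chartFrame G (chartAt _ p) (chartAt (EuclideanSpace ℝ (Fin n)) p p) := by
  ext1 i
  exact D_eq_fderiv (hG.mdifferentiable (by simp) p) _

variable [IsManifold (𝓡 n) ∞ M]

lemma contDiffOn_comp_symm {G : M → EuclideanSpace ℝ (Fin d)}
    (hG : ContMDiff (𝓡 n) 𝓘(ℝ, EuclideanSpace ℝ (Fin d)) ∞ G)
    {c : OpenPartialHomeomorph M (EuclideanSpace ℝ (Fin n))}
    (hc : c ∈ atlas (EuclideanSpace ℝ (Fin n)) M) :
    ContDiffOn ℝ ∞ (fun y => G (c.symm y)) c.target := by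
  rw [← contMDiffOn_iff_contDiffOn]
  exact hG.comp_contMDiffOn
    (contMDiffOn_symm_of_mem_maximalAtlas (IsManifold.subset_maximalAtlas hc))

lemma contDiffOn_transition {c c' : OpenPartialHomeomorph M (EuclideanSpace ℝ (Fin n))}
    (hc : c ∈ atlas (EuclideanSpace ℝ (Fin n)) M) (hc' : c' ∈ atlas (EuclideanSpace ℝ (Fin n)) M) :
    ContDiffOn ℝ ∞ (fun y => c' (c.symm y)) (c.symm.trans c').source := by
  have h1 := contMDiffOn_symm_of_mem_maximalAtlas (IsManifold.subset_maximalAtlas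
    (I := 𝓡 n) (n := ∞) hc)
  have h2 := contMDiffOn_of_mem_maximalAtlas (IsManifold.subset_maximalAtlas
    (I := 𝓡 n) (n := ∞) hc')
  rw [← contMDiffOn_iff_contDiffOn]
  refine h2.comp (h1.mono ?_) ?_
  · intro x hx; simp at hx; exact hx.1
  · intro x hx; simp at hx; exact hx.2

/-- The chain rule; the Jacobian is stored with derivatives as rows so that it acts through `comb`.
The same matrix serves every `G`, so the frames of `F` and `V` change together. -/
lemma chartFrame_eq_comb {G : M → EuclideanSpace ℝ (Fin d)}
    (hG : ContMDiff (𝓡 n) 𝓘(ℝ, EuclideanSpace ℝ (Fin d)) ∞ G)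
    {c c' : OpenPartialHomeomorph M (EuclideanSpace ℝ (Fin n))}
    (hc : c ∈ atlas (EuclideanSpace ℝ (Fin n)) M) (hc' : c' ∈ atlas (EuclideanSpace ℝ (Fin n)) M)
    {x : EuclideanSpace ℝ (Fin n)} (hx : x ∈ (c.symm.trans c').source) :
    chartFrame G c x = comb (jac c c' x) (chartFrame G c' (c' (c.symm x))) := by
  have hx' : x ∈ c.target ∧ c.symm x ∈ c'.source := by simpa using hx
  have h1 : DifferentiableAt ℝ (fun y => G (c'.symm y)) (c' (c.symm x)) :=
    ((contDiffOn_comp_symm hG hc').contDiffAt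
      (c'.open_target.mem_nhds (c'.map_source hx'.2))).differentiableAt (by simp)
  have h2 : DifferentiableAt ℝ (fun y => c' (c.symm y)) x :=
    ((contDiffOn_transition hc hc').contDiffAt
      ((c.symm.trans c').open_source.mem_nhds hx)).differentiableAt (by simp)
  have h3 : (fun y => G (c.symm y)) =ᶠ[nhds x]
      (fun y => G (c'.symm y)) ∘ (fun y => c' (c.symm y)) := by
    filter_upwards [(c.symm.trans c').open_source.mem_nhds hx] with y hy
    have hy' : y ∈ c.target ∧ c.symm y ∈ c'.source := by simpa using hy
    simp [c'.left_inv hy'.2]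
  have h4 := h3.fderiv_eq.trans (fderiv_comp x h1 h2)
  ext1 i
  simp only [chartFrame, comb, jac, Matrix.of_apply, h4, ContinuousLinearMap.comp_apply]
  conv_lhs => rw [euclidean_eq_sum_single (fderiv ℝ (fun y => c' (c.symm y)) x _)]
  simp [map_sum]

/-- The matrix expressing the coordinate vectors of `c` in those of the preferred chart. -/
lemma exists_chartFrame_eq_comb_coordFrame (horient : OrientedAtlas n M)
    {c : OpenPartialHomeomorph M (EuclideanSpace ℝ (Fin n))}
    (hc : c ∈ atlas (EuclideanSpace ℝ (Fin n)) M) {x : EuclideanSpace ℝ (Fin n)}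
    (hx : x ∈ c.target) :
    ∃ P : Matrix (Fin n) (Fin n) ℝ, 0 < P.det ∧ ∀ {G : M → EuclideanSpace ℝ (Fin d)},
      ContMDiff (𝓡 n) 𝓘(ℝ, EuclideanSpace ℝ (Fin d)) ∞ G →
        chartFrame G c x = comb P (coordFrame n G (c.symm x)) := by
  have hx' : x ∈ (c.symm.trans (chartAt (EuclideanSpace ℝ (Fin n)) (c.symm x))).source := by
    simp [hx]
  refine ⟨jac c (chartAt _ (c.symm x)) x, ?_, fun hG => ?_⟩
  · rw [det_jac]
    exact horient c hc _ (chart_mem_atlas _ _) x hx'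
  · rw [coordFrame_eq_chartFrame hG]
    exact chartFrame_eq_comb hG hc (chart_mem_atlas _ _) hx'

lemma contMDiff_of_chart {G : M → EuclideanSpace ℝ (Fin d)}
    (h : ∀ c ∈ atlas (EuclideanSpace ℝ (Fin n)) M,
      ContDiffOn ℝ ∞ (fun y => G (c.symm y)) c.target) :
    ContMDiff (𝓡 n) 𝓘(ℝ, EuclideanSpace ℝ (Fin d)) ∞ G := by
  intro p
  set c := chartAt (EuclideanSpace ℝ (Fin n)) p
  have h1 := (h c (chart_mem_atlas _ p)).contMDiffOn
  have h2 : ContMDiffOn (𝓡 n) (𝓡 n) ∞ c c.source := contMDiffOn_chart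
  have h3 := h1.comp h2 (fun y hy => c.map_source hy)
  have h4 := h3.contMDiffAt (c.open_source.mem_nhds (mem_chart_source _ p))
  refine h4.congr_of_eventuallyEq ?_
  filter_upwards [c.open_source.mem_nhds (mem_chart_source _ p)] with y hy
  simp [c.left_inv hy]

/-- In a chart, `V` is the partial `s`-derivative at `s = 0` of a map smooth on `[0, ε) × c.target`.
Derivatives within this set are unique up to the boundary, so a one-sided family still gives a
smooth field. -/
lemma IsNormalVariation.contMDiff_field {F : M → EuclideanSpace ℝ (Fin d)} {ε : ℝ}
    {Φ : ℝ → M → EuclideanSpace ℝ (Fin d)} {V : M → EuclideanSpace ℝ (Fin d)}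
    (hV : IsNormalVariation n F ε Φ V) :
    ContMDiff (𝓡 n) 𝓘(ℝ, EuclideanSpace ℝ (Fin d)) ∞ V := by
  refine contMDiff_of_chart fun c hc => ?_
  set S : Set (ℝ × EuclideanSpace ℝ (Fin n)) := Set.Ico 0 ε ×ˢ c.target
  set Ψ : ℝ × EuclideanSpace ℝ (Fin n) → EuclideanSpace ℝ (Fin d) :=
    fun q => Φ q.1 (c.symm q.2)
  have hΨ' : ContMDiffOn (𝓘(ℝ, ℝ).prod (𝓡 n)) 𝓘(ℝ, EuclideanSpace ℝ (Fin d)) ∞ Ψ S := by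
    refine hV.smooth.comp (f := fun q : ℝ × EuclideanSpace ℝ (Fin n) => (q.1, c.symm q.2))
      (contMDiffOn_fst.prodMk ?_) (fun q hq => ⟨hq.1, trivial⟩)
    exact (contMDiffOn_symm_of_mem_maximalAtlas (IsManifold.subset_maximalAtlas hc)).comp
      contMDiffOn_snd (fun q hq => hq.2)
  have hΨ : ContDiffOn ℝ ∞ Ψ S := by
    -- The product manifold structure on `ℝ × ℝⁿ` has to be identified with that of a single normed
    -- space.
    rw [← contMDiffOn_iff_contDiffOn, modelWithCornersSelf_prod, ← chartedSpaceSelf_prod]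
    exact hΨ'
  have hS : UniqueDiffOn ℝ S := (uniqueDiffOn_Ico 0 ε).prod c.open_target.uniqueDiffOn
  have h0 : (0 : ℝ) ∈ Set.Ico 0 ε := ⟨le_rfl, hV.pos⟩
  have h1 : ContDiffOn ℝ ∞ (fun q => fderivWithin ℝ Ψ S q (1, 0)) S :=
    (hΨ.fderivWithin hS (m := ∞) (by simp)).clm_apply contDiffOn_const
  have h2 : ContDiffOn ℝ ∞ (fun x => fderivWithin ℝ Ψ S (0, x) (1, 0)) c.target :=
    h1.comp (f := fun x : EuclideanSpace ℝ (Fin n) => ((0 : ℝ), x))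
      (contDiffOn_const.prodMk contDiffOn_id) (fun x hx => ⟨h0, hx⟩)
  refine h2.congr fun x hx => ?_
  have h3 : HasFDerivWithinAt Ψ (fderivWithin ℝ Ψ S (0, x)) S (0, x) :=
    (hΨ.differentiableOn (by simp) (0, x) ⟨h0, hx⟩).hasFDerivWithinAt
  have h4 : HasDerivWithinAt (fun s : ℝ => (s, x)) ((1 : ℝ), (0 : EuclideanSpace ℝ (Fin n)))
      (Set.Ico 0 ε) 0 := (hasDerivWithinAt_id _ _).prodMk (hasDerivWithinAt_const _ _ _)
  have hm : Set.MapsTo (fun s : ℝ => (s, x)) (Set.Ico 0 ε) S := fun s hs => ⟨hs, hx⟩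
  have h5 := h3.comp_hasDerivWithinAt (0 : ℝ) h4 hm
  exact ((uniqueDiffOn_Ico 0 ε).uniqueDiffWithinAt h0).eq_deriv _ (hV.field (c.symm x)) h5

end Charts

/-! ### The pointwise identity between the two integrands -/

section Pointwise

variable {n d : ℕ} {M : Type*} [TopologicalSpace M] [ChartedSpace (EuclideanSpace ℝ (Fin n)) M]

lemma exists_tanPart_eq_comb (F : M → EuclideanSpace ℝ (Fin d)) (p : M)
    (w : Fin n → EuclideanSpace ℝ (Fin d)) :
    ∃ U : Matrix (Fin n) (Fin n) ℝ,
      (fun i => tanPart (n := n) F p (w i)) = comb U (coordFrame n F p) := by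
  have h : ∀ i, ∃ u : TangentSpace (𝓡 n) p, D F p u = tanPart (n := n) F p (w i) := fun i =>
    Submodule.starProjection_apply_mem (LinearMap.range (D (n := n) F p).toLinearMap) (w i)
  choose u hu using h
  refine ⟨Matrix.of fun i j : Fin n => (show EuclideanSpace ℝ (Fin n) from u i) j, ?_⟩
  simp_rw [← hu]
  exact D_eq_comb F p u

lemma inner_norPart_D (F : M → EuclideanSpace ℝ (Fin d)) (p : M) (w : EuclideanSpace ℝ (Fin d))
    (u : TangentSpace (𝓡 n) p) : ⟪norPart (n := n) F p w, D F p u⟫_ℝ = 0 := by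
  rw [real_inner_comm]
  exact (Submodule.mem_orthogonal _ _).1 (Submodule.sub_starProjection_mem_orthogonal
    (K := LinearMap.range (D (n := n) F p).toLinearMap) w) _ ⟨u, rfl⟩

lemma norPart_add_tanPart (F : M → EuclideanSpace ℝ (Fin d)) (p : M)
    (w : EuclideanSpace ℝ (Fin d)) :
    norPart (n := n) F p w + tanPart (n := n) F p w = w := sub_add_cancel _ _

lemma normSqNormalDeriv_eq {F : M → EuclideanSpace ℝ (Fin d)} {p : M}
    (hF : Function.Injective (D (n := n) F p)) (V : M → EuclideanSpace ℝ (Fin d)) :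
    normSqNormalDeriv n F V p = normalEnergy (coordFrame n F p) (coordFrame n V p) := by
  obtain ⟨U, hU⟩ := exists_tanPart_eq_comb (n := n) F p (coordFrame n V p)
  set ν : Fin n → EuclideanSpace ℝ (Fin d) :=
    fun i => norPart (n := n) F p (coordFrame n V p i) with hν
  have h1 : coordFrame n V p = ν + comb U (coordFrame n F p) := by
    rw [← hU]
    ext1 i
    exact (norPart_add_tanPart _ _ _).symm
  have h2 : gramMat ν (coordFrame n F p) = 0 := by
    ext i j
    exact inner_norPart_D F p _ _
  rw [h1, normalEnergy_add_comb (linearIndependent_coordFrame hF) h2,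
    ← gramMat_transpose ν, Matrix.trace]
  simp only [Matrix.diag_apply, Matrix.mul_apply, Matrix.transpose_apply]
  rfl

lemma hodgeStar_eq (Ω : EuclideanSpace ℝ (Fin d) → EuclideanSpace ℝ (Fin d) [⋀^Fin n]→L[ℝ] ℝ)
    (F : M → EuclideanSpace ℝ (Fin d)) (p : M) :
    hodgeStar Ω F p = unitValue (Ω (F p)) (coordFrame n F p) := rfl

variable [IsManifold (𝓡 n) ∞ M] {F V : M → EuclideanSpace ℝ (Fin d)}

lemma contDiffAt_chart {G : M → EuclideanSpace ℝ (Fin d)}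
    (hG : ContMDiff (𝓡 n) 𝓘(ℝ, EuclideanSpace ℝ (Fin d)) ∞ G) (p : M) :
    ContDiffAt ℝ ∞ (fun y => G ((chartAt (EuclideanSpace ℝ (Fin n)) p).symm y))
      (chartAt (EuclideanSpace ℝ (Fin n)) p p) :=
  (contDiffOn_comp_symm hG (chart_mem_atlas _ p)).contDiffAt
    ((chartAt _ p).open_target.mem_nhds (mem_chart_target _ p))

lemma secondPartial_eq (hF : ContMDiff (𝓡 n) 𝓘(ℝ, EuclideanSpace ℝ (Fin d)) ∞ F) (p : M)
    (i j : Fin n) :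
    secondPartial F p i j =
      fderiv ℝ (fderiv ℝ (fun y => F ((chartAt (EuclideanSpace ℝ (Fin n)) p).symm y)))
        (chartAt (EuclideanSpace ℝ (Fin n)) p p) (EuclideanSpace.single i 1)
        (EuclideanSpace.single j 1) := by
  have h : DifferentiableAt ℝ
      (fderiv ℝ (fun y => F ((chartAt (EuclideanSpace ℝ (Fin n)) p).symm y)))
      (chartAt (EuclideanSpace ℝ (Fin n)) p p) :=
    ((contDiffAt_chart hF p).fderiv_right (m := 1) (by norm_cast)).differentiableAt (by simp)
  unfold secondPartial
  rw [fderiv_clm_apply h (differentiableAt_const _)]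
  simp

lemma secondPartial_symm (hF : ContMDiff (𝓡 n) 𝓘(ℝ, EuclideanSpace ℝ (Fin d)) ∞ F) (p : M)
    (i j : Fin n) : secondPartial F p i j = secondPartial F p j i := by
  rw [secondPartial_eq hF, secondPartial_eq hF]
  exact ((contDiffAt_chart hF p).isSymmSndFDerivAt (by simp; norm_cast)).eq _ _

/-- Differentiate `⟨∂ⱼF, V⟩ = 0` in the direction `∂ᵢ`. The second fundamental form paired with `V`
is thereby a first-order expression in `V`. -/
lemma inner_secondPartial (hF : ContMDiff (𝓡 n) 𝓘(ℝ, EuclideanSpace ℝ (Fin d)) ∞ F)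
    (hV : ContMDiff (𝓡 n) 𝓘(ℝ, EuclideanSpace ℝ (Fin d)) ∞ V)
    (hn : ∀ (p : M) (w : TangentSpace (𝓡 n) p), ⟪V p, D F p w⟫_ℝ = 0) (p : M) (i j : Fin n) :
    ⟪secondPartial F p i j, V p⟫_ℝ =
      -gramMat (coordFrame n V p) (coordFrame n F p) i j := by
  set c := chartAt (EuclideanSpace ℝ (Fin n)) p with hc
  set f := fun y => F (c.symm y) with hf
  set v := fun y => V (c.symm y) with hv
  have h1 : DifferentiableAt ℝ (fderiv ℝ f) (c p) :=
    ((contDiffAt_chart hF p).fderiv_right (m := 1) (by norm_cast)).differentiableAt (by simp)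
  have h1' : DifferentiableAt ℝ (fun y => fderiv ℝ f y (EuclideanSpace.single j 1)) (c p) :=
    h1.clm_apply (differentiableAt_const _)
  have h2 : DifferentiableAt ℝ v (c p) := (contDiffAt_chart hV p).differentiableAt (by simp)
  have h3 : (fun y => ⟪fderiv ℝ f y (EuclideanSpace.single j 1), v y⟫_ℝ) =ᶠ[nhds (c p)] 0 := by
    filter_upwards [c.open_target.mem_nhds (mem_chart_target _ p)] with y hy
    -- The coordinate vectors of the fixed chart at `p` must be rewritten in the preferred chart of
    -- the nearby point, where normality applies.
    have hy' : y ∈ (c.symm.trans (chartAt (EuclideanSpace ℝ (Fin n)) (c.symm y))).source := by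
      simp [hy]
    have := congrFun (chartFrame_eq_comb hF (chart_mem_atlas _ p) (chart_mem_atlas _ (c.symm y))
      hy') j
    rw [← coordFrame_eq_chartFrame hF] at this
    change fderiv ℝ f y (EuclideanSpace.single j 1) = _ at this
    rw [this]
    simp only [comb, sum_inner, inner_smul_left, Pi.zero_apply]
    refine Finset.sum_eq_zero fun k _ => ?_
    rw [real_inner_comm]
    exact mul_eq_zero_of_right _ (hn _ _)
  have h4 := congrArg (fun l : EuclideanSpace ℝ (Fin n) →L[ℝ] ℝ => l (EuclideanSpace.single i (1 : ℝ))) h3.fderiv_eq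
  simp only [fderiv_inner_apply ℝ h1' h2] at h4
  have h5 : fderiv ℝ (0 : EuclideanSpace ℝ (Fin n) → ℝ) (c p) = 0 := fderiv_const_apply (0 : ℝ)
  rw [h5, zero_apply] at h4
  have e1 : v (c p) = V p := by simp [hv, hc]
  have e2 : coordFrame n V p i = fderiv ℝ v (c p) (EuclideanSpace.single i 1) :=
    congrFun (coordFrame_eq_chartFrame hV p) i
  have e3 : coordFrame n F p j = fderiv ℝ f (c p) (EuclideanSpace.single j 1) :=
    congrFun (coordFrame_eq_chartFrame hF p) j
  rw [e1] at h4
  simp only [gramMat, Matrix.of_apply, e2, e3]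
  rw [real_inner_comm (fderiv ℝ f (c p) (EuclideanSpace.single j 1))]
  exact eq_neg_of_add_eq_zero_right h4

/-- Self-adjointness of the shape operator, inherited from the symmetry of the second partials of
`F`. -/
lemma gramMat_coordFrame_symm (hF : ContMDiff (𝓡 n) 𝓘(ℝ, EuclideanSpace ℝ (Fin d)) ∞ F)
    (hV : ContMDiff (𝓡 n) 𝓘(ℝ, EuclideanSpace ℝ (Fin d)) ∞ V)
    (hn : ∀ (p : M) (w : TangentSpace (𝓡 n) p), ⟪V p, D F p w⟫_ℝ = 0) (p : M) :
    (gramMat (coordFrame n V p) (coordFrame n F p)).transpose =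
      gramMat (coordFrame n V p) (coordFrame n F p) := by
  ext i j
  have h1 := inner_secondPartial hF hV hn p i j
  have h2 := inner_secondPartial hF hV hn p j i
  rw [secondPartial_symm hF] at h2
  rw [Matrix.transpose_apply]
  linarith

/-- The minus signs from the two factors cancel; what remains is a reordering of the four sums to
match the trace. -/
lemma B_eq (hF : ContMDiff (𝓡 n) 𝓘(ℝ, EuclideanSpace ℝ (Fin d)) ∞ F)
    (hV : ContMDiff (𝓡 n) 𝓘(ℝ, EuclideanSpace ℝ (Fin d)) ∞ V)
    (hn : ∀ (p : M) (w : TangentSpace (𝓡 n) p), ⟪V p, D F p w⟫_ℝ = 0) (p : M) :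
    B n F V p = tangentEnergy (coordFrame n F p) (coordFrame n V p) := by
  have hG : (metric (n := n) F p) = gramMat (coordFrame n F p) (coordFrame n F p) := rfl
  unfold B tangentEnergy doubleTrace
  simp_rw [inner_secondPartial hF hV hn, hG]
  set S := gramMat (coordFrame n V p) (coordFrame n F p)
  set H := (gramMat (coordFrame n F p) (coordFrame n F p))⁻¹ with hH
  have hsym : ∀ i j, H i j = H j i := fun i j => by
    rw [← Matrix.transpose_apply H, hH, Matrix.transpose_nonsing_inv, gramMat_transpose]
  simp only [Matrix.trace, Matrix.diag_apply, Matrix.mul_apply, Matrix.transpose_apply,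
    Finset.sum_mul]
  calc ∑ i, ∑ j, ∑ k, ∑ l, H i k * H j l * -S i j * -S k l
      = ∑ i, ∑ k, ∑ j, ∑ l, H i k * H j l * -S i j * -S k l :=
        Finset.sum_congr rfl fun i _ => Finset.sum_comm
    _ = ∑ k, ∑ i, ∑ j, ∑ l, H i k * H j l * -S i j * -S k l := Finset.sum_comm
    _ = ∑ k, ∑ i, ∑ l, ∑ j, H i k * H j l * -S i j * -S k l :=
        Finset.sum_congr rfl fun k _ => Finset.sum_congr rfl fun i _ => Finset.sum_comm
    _ = ∑ k, ∑ l, ∑ i, ∑ j, H i k * H j l * -S i j * -S k l :=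
        Finset.sum_congr rfl fun k _ => Finset.sum_comm
    _ = ∑ k, ∑ l, ∑ j, ∑ i, H i k * H j l * -S i j * -S k l :=
        Finset.sum_congr rfl fun k _ => Finset.sum_congr rfl fun l _ => Finset.sum_comm
    _ = _ := by
        refine Finset.sum_congr rfl fun k _ => Finset.sum_congr rfl fun l _ =>
          Finset.sum_congr rfl fun j _ => Finset.sum_congr rfl fun i _ => ?_
        rw [hsym i k]
        ring

/-- Pair the vanishing mean curvature vector with `V`: as `V` is normal, projecting the second
partials to the normal space does not change the pairing. -/
lemma trace_secondForm_eq_zero (hF : ContMDiff (𝓡 n) 𝓘(ℝ, EuclideanSpace ℝ (Fin d)) ∞ F)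
    (hV : ContMDiff (𝓡 n) 𝓘(ℝ, EuclideanSpace ℝ (Fin d)) ∞ V)
    (hn : ∀ (p : M) (w : TangentSpace (𝓡 n) p), ⟪V p, D F p w⟫_ℝ = 0)
    (hmin : IsMinimal n F) (p : M) :
    ((gramMat (coordFrame n F p) (coordFrame n F p))⁻¹ *
      gramMat (coordFrame n V p) (coordFrame n F p)).trace = 0 := by
  have h := congrArg (fun v => ⟪v, V p⟫_ℝ) (hmin p)
  have h1 : ∀ w, ⟪norPart (n := n) F p w, V p⟫_ℝ = ⟪w, V p⟫_ℝ := by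
    intro w
    obtain ⟨u, hu⟩ : ∃ u : TangentSpace (𝓡 n) p, D F p u = tanPart (n := n) F p w :=
      Submodule.starProjection_apply_mem (LinearMap.range (D (n := n) F p).toLinearMap) w
    rw [norPart, inner_sub_left, ← hu, real_inner_comm _ (D F p u), hn, sub_zero]
  simp only [sum_inner, inner_smul_left, h1, inner_secondPartial hF hV hn, inner_zero_left,
    RCLike.conj_to_real, mul_neg, Finset.sum_neg_distrib, neg_eq_zero] at h
  rw [← gramMat_coordFrame_symm hF hV hn]
  simp only [Matrix.trace, Matrix.diag_apply, Matrix.mul_apply, Matrix.transpose_apply]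
  exact h

/-- The difference of the two integrands is the second variation density of `Ω`. -/
lemma integrand_eq (hF : IsSmoothImmersion n F)
    (hV : ContMDiff (𝓡 n) 𝓘(ℝ, EuclideanSpace ℝ (Fin d)) ∞ V)
    (hn : ∀ (p : M) (w : TangentSpace (𝓡 n) p), ⟪V p, D F p w⟫_ℝ = 0) (hmin : IsMinimal n F)
    (Ω : EuclideanSpace ℝ (Fin d) → EuclideanSpace ℝ (Fin d) [⋀^Fin n]→L[ℝ] ℝ)
    {e : ∀ p : M, Fin n → TangentSpace (𝓡 n) p} (he : IsOrientedOrthonormalFrame F e) (p : M) :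
    hodgeStar Ω F p * normSqNormalDeriv n F V p
        - 2 * pairSum Ω F p (e p) (fun i => tanPart (n := n) F p (D V p (e p i)))
            (fun i => norPart (n := n) F p (D V p (e p i)))
        - 2 * pairSum Ω F p (e p) (fun i => norPart (n := n) F p (D V p (e p i)))
            (fun i => norPart (n := n) F p (D V p (e p i)))
        - 2 * pairSum Ω F p (e p) (fun i => norPart (n := n) F p (D V p (e p i)))
            (fun i => tanPart (n := n) F p (D V p (e p i))) =
      hodgeStar Ω F p * (normSqNormalDeriv n F V p - B n F V p) -
        mixedDensity (Ω (F p)) (coordFrame n F p) (coordFrame n V p) (coordFrame n V p) := by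
  set P : Matrix (Fin n) (Fin n) ℝ :=
    Matrix.of fun i j : Fin n => (show EuclideanSpace ℝ (Fin n) from e p i) j with hPdef
  have hP : 0 < P.det := he.oriented p
  set a := coordFrame n F p with ha
  set w := coordFrame n V p with hw
  have ea : (fun i => D F p (e p i)) = comb P a := D_eq_comb F p (e p)
  have ew : (fun i => D V p (e p i)) = comb P w := D_eq_comb V p (e p)
  have h1 : gramMat (comb P a) (comb P a) = 1 := by
    rw [← ea]
    ext i j
    simp [gramMat, Matrix.one_apply, orthonormal_iff_ite.1 (he.orthonormal p) i j]
  set N : Fin n → EuclideanSpace ℝ (Fin d) := fun i => norPart (n := n) F p (D V p (e p i)) with hN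
  set T : Fin n → EuclideanSpace ℝ (Fin d) := fun i => tanPart (n := n) F p (D V p (e p i)) with hT
  have hNT : comb P w = N + T := by
    rw [← ew]
    ext1 i
    exact (norPart_add_tanPart _ _ _).symm
  obtain ⟨U, hU⟩ := exists_tanPart_eq_comb (n := n) F p (fun i => D V p (e p i))
  have ha' : a = comb P⁻¹ (comb P a) := by
    rw [comb_comb, Matrix.nonsing_inv_mul _ hP.ne'.isUnit, one_comb]
  have hT' : T = comb (U * P⁻¹) (comb P a) := by
    rw [← comb_comb, ← ha']
    exact hU
  have hNa : gramMat N (comb P a) = 0 := by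
    rw [← ea]
    ext i j
    exact inner_norPart_D F p _ _
  have hS : gramMat (comb P w) (comb P a) = U * P⁻¹ := by
    rw [hNT, hT', gramMat_add_comb hNa, h1, Matrix.mul_one]
  -- In an orthonormal frame the coefficients of the tangential part are the inner products of `w`
  -- with the frame.
  have hTS : T = comb (gramMat (comb P w) (comb P a)) (comb P a) := by rw [hS, hT']
  have hsym : (gramMat (comb P w) (comb P a)).transpose = gramMat (comb P w) (comb P a) := by
    rw [gramMat_comb, Matrix.transpose_mul, Matrix.transpose_mul, Matrix.transpose_transpose,
      gramMat_coordFrame_symm hF.smooth hV hn, Matrix.mul_assoc]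
  have htr : (gramMat (comb P w) (comb P a)).trace = 0 := by
    have := trace_inv_gramMat_comb hP.ne' a (gramMat w a)
    rw [trace_secondForm_eq_zero hF.smooth hV hn hmin, ← gramMat_comb, h1] at this
    simpa using this
  have key := two_mul_ltSum_tangential (Ω (F p)) h1 hsym htr
  rw [← hTS, unitValue_comb _ hP, tangentEnergy_comb hP.ne'] at key
  have hm := mixedDensity_comb (Ω (F p)) hP a w w
  have hm' : mixedDensity (Ω (F p)) (comb P a) (comb P w) (comb P w) =
      2 * ltSum (Ω (F p)) (comb P a) (comb P w) (comb P w) := by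
    rw [mixedDensity, h1, mixedSum_self]
    simp
  -- The mixed density is the sum of the four pair sums; `key` evaluates the tangential-tangential
  -- one.
  rw [← hm, hm', hNT, ltSum_add, B_eq hF.smooth hV hn, hodgeStar_eq]
  have hp : ∀ x y, pairSum Ω F p (e p) x y = ltSum (Ω (F p)) (comb P a) x y := by
    intro x y
    rw [← ea]
    rfl
  rw [hp, hp, hp]
  linarith

end Pointwise

/-! ### Integration by parts in Euclidean space -/

section IntegrationByParts

open MeasureTheory

variable {n : ℕ} {E : Type*} [NormedAddCommGroup E] [InnerProductSpace ℝ E]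

lemma alternating_update_swap (α : E [⋀^Fin n]→L[ℝ] ℝ) (a : Fin n → E) {i j : Fin n} (hij : i ≠ j)
    (x y : E) :
    α (Function.update (Function.update a i x) j y) =
      -α (Function.update (Function.update a i y) j x) := by
  have e : Function.update (Function.update a i x) j y =
      Function.update (Function.update a i y) j x ∘ Equiv.swap i j := by
    ext1 k
    by_cases hkj : k = j
    · subst hkj; simp [hij]
    · by_cases hki : k = i
      · subst hki; simp [hkj]
      · simp [hkj, hki, Equiv.swap_apply_of_ne_of_ne]
  rw [e]
  exact α.toAlternatingMap.map_swap _ hij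

lemma sum_eq_zero_of_antisymm (A : Fin n → Fin n → ℝ) (h : ∀ i j, A i j = -A j i) :
    ∑ i, ∑ j, A i j = 0 := by
  have h1 : ∑ i, ∑ j, A i j = -∑ i, ∑ j, A i j := by
    conv_lhs => rw [Finset.sum_comm]
    simp_rw [← Finset.sum_neg_distrib]
    exact Finset.sum_congr rfl fun i _ => Finset.sum_congr rfl fun j _ => h j i
  linarith

/-- The terms with second derivatives cancel in the divergence of
`(i) ↦ ∑ j, α (a₁, …, u, …, vⱼ, …, aₙ)`. -/
lemma sum_divergence_eq_mixedSum (α : E [⋀^Fin n]→L[ℝ] ℝ) (a du v : Fin n → E) (u : E)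
    (Ha Hv : Fin n → Fin n → E) (hHa : ∀ i j, Ha i j = Ha j i) (hHv : ∀ i j, Hv i j = Hv j i) :
    ∑ i, ∑ j, (if i = j then 0 else
      ∑ k, α (Function.update (Function.update (Function.update a i u) j (v j)) k
        (if k = j then Hv i j else if k = i then du i else Ha i k))) = mixedSum α a du v := by
  -- `A` collects the terms where the derivative hits the entry `∂ⱼv`: antisymmetric in `i, j`,
  -- since the Hessian is symmetric and swapping the two places changes the sign.
  set A : Fin n → Fin n → ℝ := fun i j => if i = j then 0 else
    α (Function.update (Function.update a i u) j (Hv i j)) with hA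
  -- `C` collects the terms where it hits a third entry `∂ₖf`: antisymmetric in `i, k` for each
  -- fixed `j`.
  set C : Fin n → Fin n → Fin n → ℝ := fun j i k => if i = j ∨ k = j ∨ k = i then 0 else
    α (Function.update (Function.update (Function.update a i u) j (v j)) k (Ha i k)) with hC
  have hA0 : ∑ i, ∑ j, A i j = 0 := by
    refine sum_eq_zero_of_antisymm A fun i j => ?_
    by_cases hij : i = j
    · simp [hA, hij]
    · simp only [hA, hij, Ne.symm hij, if_false]
      rw [alternating_update_swap α a hij, Function.update_comm hij, hHv]
  have hC0 : ∀ j, ∑ i, ∑ k, C j i k = 0 := by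
    intro j
    refine sum_eq_zero_of_antisymm (C j) fun i k => ?_
    by_cases h : i = j ∨ k = j ∨ k = i
    · have h' : k = j ∨ i = j ∨ i = k := by tauto
      simp [hC, h, h']
    · have h' : ¬ (k = j ∨ i = j ∨ i = k) := by tauto
      simp only [hC, h, h', if_false]
      push Not at h
      obtain ⟨hij, hkj, hki⟩ := h
      rw [Function.update_comm hij, alternating_update_swap α _ (Ne.symm hki),
        Function.update_comm (Ne.symm hki), Function.update_comm hkj, hHa]
  have key : ∀ i j, (if i = j then 0 else
      ∑ k, α (Function.update (Function.update (Function.update a i u) j (v j)) k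
        (if k = j then Hv i j else if k = i then du i else Ha i k))) =
      (if i = j then 0 else α (Function.update (Function.update a i (du i)) j (v j))) + A i j +
        ∑ k, C j i k := by
    intro i j
    by_cases hij : i = j
    · simp [hA, hC, hij]
    · simp only [hij, if_false, hA, hC, false_or]
      have hk : ∀ k, α (Function.update (Function.update (Function.update a i u) j (v j)) k
          (if k = j then Hv i j else if k = i then du i else Ha i k)) =
          (if k = i then α (Function.update (Function.update a i (du i)) j (v j)) else 0) +
          (if k = j then α (Function.update (Function.update a i u) j (Hv i j)) else 0) +
          (if k = j ∨ k = i then 0 else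
            α (Function.update (Function.update (Function.update a i u) j (v j)) k (Ha i k))) := by
        intro k
        by_cases hkj : k = j
        · subst hkj; simp [Ne.symm hij]
        · by_cases hki : k = i
          · subst hki
            simp only [hkj, if_false, if_true, or_true, add_zero]
            rw [Function.update_comm hkj, Function.update_idem, Function.update_comm hkj]
          · simp [hkj, hki]
      simp_rw [hk, Finset.sum_add_distrib]
      simp
  simp_rw [key, Finset.sum_add_distrib, hA0]
  rw [Finset.sum_comm (f := fun i j => ∑ k, C j i k)]
  simp_rw [hC0]
  simp [mixedSum]

/-- Integration by parts against the constant function `1`. -/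
lemma integral_fderiv_apply_eq_zero {X : EuclideanSpace ℝ (Fin n) → ℝ} (hX : ContDiff ℝ 1 X)
    (hs : HasCompactSupport X) (v : EuclideanSpace ℝ (Fin n)) :
    ∫ x, fderiv ℝ X x v = 0 := by
  have h1 : Integrable (fun x => fderiv ℝ X x v) :=
    ((hX.continuous_fderiv (by simp)).clm_apply continuous_const).integrable_of_hasCompactSupport
      ((hs.fderiv ℝ).mono' (fun x hx => by
        by_contra h
        exact hx (by simp [image_eq_zero_of_notMem_tsupport h])))
  have := integral_mul_fderiv_eq_neg_fderiv_mul_of_integrable (𝕜 := ℝ) (μ := volume)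
    (f := fun _ : EuclideanSpace ℝ (Fin n) => (1 : ℝ)) (g := X) (v := v) (by simp) (by simpa using h1)
    (by simpa using hX.continuous.integrable_of_hasCompactSupport hs)
    (fun _ _ => differentiableAt_const _) (fun x _ => hX.differentiable (by simp) x)
  simpa using this

/-- The coordinate derivatives of a map. -/
def partials (f : EuclideanSpace ℝ (Fin n) → E) (x : EuclideanSpace ℝ (Fin n)) : Fin n → E :=
  fun i => fderiv ℝ f x (EuclideanSpace.single i 1)

lemma contDiffAt_partials {f : EuclideanSpace ℝ (Fin n) → E} {x : EuclideanSpace ℝ (Fin n)}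
    (hf : ContDiffAt ℝ ∞ f x) (i : Fin n) : ContDiffAt ℝ 1 (fun y => partials f y i) x :=
  (hf.fderiv_right (m := 1) (by norm_cast)).clm_apply contDiffAt_const

lemma partials_partials_symm {f : EuclideanSpace ℝ (Fin n) → E} {x : EuclideanSpace ℝ (Fin n)}
    (hf : ContDiffAt ℝ ∞ f x) (i j : Fin n) :
    fderiv ℝ (fun y => partials f y j) x (EuclideanSpace.single i 1) =
      fderiv ℝ (fun y => partials f y i) x (EuclideanSpace.single j 1) := by
  have h : DifferentiableAt ℝ (fderiv ℝ f) x :=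
    (hf.fderiv_right (m := 1) (by norm_cast)).differentiableAt (by simp)
  unfold partials
  rw [fderiv_clm_apply h (differentiableAt_const _), fderiv_clm_apply h (differentiableAt_const _)]
  simpa using (hf.isSymmSndFDerivAt (by simp; norm_cast)).eq _ _

/-- The vector field whose divergence is `mixedSum`. -/
def fluxTuple (f u v : EuclideanSpace ℝ (Fin n) → E) (i j : Fin n)
    (x : EuclideanSpace ℝ (Fin n)) : Fin n → E :=
  Function.update (Function.update (partials f x) i (u x)) j (partials v x j)

lemma contDiffAt_fluxTuple {f u v : EuclideanSpace ℝ (Fin n) → E} {x : EuclideanSpace ℝ (Fin n)}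
    (hf : ContDiffAt ℝ ∞ f x) (hu : ContDiffAt ℝ ∞ u x) (hv : ContDiffAt ℝ ∞ v x) (i j : Fin n) :
    ContDiffAt ℝ 1 (fluxTuple f u v i j) x := by
  rw [contDiffAt_pi]
  intro k
  unfold fluxTuple
  by_cases hkj : k = j
  · subst hkj; simpa using contDiffAt_partials hv k
  · by_cases hki : k = i
    · subst hki; simpa [hkj] using hu.of_le (by norm_cast)
    · simpa [hkj, hki] using contDiffAt_partials hf k

lemma fderiv_alternating_fluxTuple (α : E [⋀^Fin n]→L[ℝ] ℝ)
    {f u v : EuclideanSpace ℝ (Fin n) → E} {x : EuclideanSpace ℝ (Fin n)}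
    (hf : ContDiffAt ℝ ∞ f x) (hu : ContDiffAt ℝ ∞ u x) (hv : ContDiffAt ℝ ∞ v x) {i j : Fin n}
    (hij : i ≠ j) :
    fderiv ℝ (fun y => α (fluxTuple f u v i j y)) x (EuclideanSpace.single i 1) =
      ∑ k, α (Function.update (fluxTuple f u v i j x) k
        (if k = j then fderiv ℝ (fun y => partials v y j) x (EuclideanSpace.single i 1)
          else if k = i then partials u x i
          else fderiv ℝ (fun y => partials f y k) x (EuclideanSpace.single i 1))) := by
  have h1 : DifferentiableAt ℝ (fluxTuple f u v i j) x :=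
    (contDiffAt_fluxTuple hf hu hv i j).differentiableAt (by simp)
  have h2 := (α.hasFDerivAt (fluxTuple f u v i j x)).comp x h1.hasFDerivAt
  have h3 := h2.fderiv
  have h4 : (fun y => α (fluxTuple f u v i j y)) = α ∘ fluxTuple f u v i j := rfl
  rw [h4, h3, ContinuousLinearMap.comp_apply, ContinuousMultilinearMap.linearDeriv_apply]
  refine Finset.sum_congr rfl fun k _ => ?_
  have h5 : fderiv ℝ (fluxTuple f u v i j) x (EuclideanSpace.single i 1) k =
      fderiv ℝ (fun y => fluxTuple f u v i j y k) x (EuclideanSpace.single i 1) := by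
    rw [fderiv_apply h1]
    rfl
  have h6 : fderiv ℝ (fluxTuple f u v i j) x (EuclideanSpace.single i 1) k =
      (if k = j then fderiv ℝ (fun y => partials v y j) x (EuclideanSpace.single i 1)
          else if k = i then partials u x i
          else fderiv ℝ (fun y => partials f y k) x (EuclideanSpace.single i 1)) := by
    rw [h5]
    unfold fluxTuple
    by_cases hkj : k = j
    · subst hkj; simp
    · by_cases hki : k = i
      · subst hki; simp [hkj, partials]
      · simp [hkj, hki]
  rw [h6]
  rfl

/-- Integration by parts: `mixedSum` is a divergence. -/
lemma setIntegral_mixedSum_eq_zero (α : E [⋀^Fin n]→L[ℝ] ℝ)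
    {f u v : EuclideanSpace ℝ (Fin n) → E} {U K : Set (EuclideanSpace ℝ (Fin n))}
    (hU : IsOpen U) (hK : IsCompact K) (hKU : K ⊆ U)
    (hf : ContDiffOn ℝ ∞ f U) (hu : ContDiffOn ℝ ∞ u U) (hv : ContDiffOn ℝ ∞ v U)
    (huK : ∀ x ∈ U, x ∉ K → u x = 0) :
    ∫ x in U, mixedSum α (partials f x) (partials u x) (partials v x) = 0 := by
  -- Extended by zero outside `U`. This is `C¹` on the whole space because the entry `u` kills it
  -- off the compact set `K ⊆ U`; `v` needs no support condition.
  set X : Fin n → Fin n → EuclideanSpace ℝ (Fin n) → ℝ := fun i j =>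
    U.indicator fun x => if i = j then 0 else α (fluxTuple f u v i j x) with hX
  have hX0 : ∀ i j x, x ∉ K → X i j x = 0 := by
    intro i j x hx
    refine Set.indicator_apply_eq_zero.2 fun hxU => ite_eq_left_iff.2 fun hij => ?_
    refine α.map_coord_zero i ?_
    simp [fluxTuple, hij, huK x hxU hx]
  have hXK : ∀ i j x, x ∉ K → X i j =ᶠ[nhds x] 0 := fun i j x hx => by
    filter_upwards [hK.isClosed.isOpen_compl.mem_nhds hx] with y hy using hX0 i j y hy
  have hXU : ∀ i j x, x ∈ U →
      X i j =ᶠ[nhds x] fun x => if i = j then 0 else α (fluxTuple f u v i j x) := by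
    intro i j x hx
    filter_upwards [hU.mem_nhds hx] with y hy
    simp [hX, hy]
  have hXs : ∀ i j, HasCompactSupport (X i j) := fun i j =>
    HasCompactSupport.intro hK (fun x hx => hX0 i j x hx)
  have hXd : ∀ i j, ContDiff ℝ 1 (X i j) := by
    intro i j
    rw [contDiff_iff_contDiffAt]
    intro x
    by_cases hx : x ∈ U
    · refine ContDiffAt.congr_of_eventuallyEq ?_ (hXU i j x hx)
      by_cases hij : i = j
      · simpa [hij] using contDiffAt_const
      · simp only [hij, if_false]
        have hn := hU.mem_nhds hx
        exact α.contDiff.contDiffAt.comp x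
          (contDiffAt_fluxTuple (hf.contDiffAt hn) (hu.contDiffAt hn) (hv.contDiffAt hn) i j)
    · exact contDiffAt_const.congr_of_eventuallyEq (hXK i j x fun h => hx (hKU h))
  have hdiv : ∀ x, ∑ i, ∑ j, fderiv ℝ (X i j) x (EuclideanSpace.single i 1) =
      U.indicator (fun x => mixedSum α (partials f x) (partials u x) (partials v x)) x := by
    intro x
    by_cases hx : x ∈ U
    · have hn := hU.mem_nhds hx
      rw [Set.indicator_of_mem hx, ← sum_divergence_eq_mixedSum α (partials f x) (partials u x)
        (partials v x) (u x)
        (fun i k => fderiv ℝ (fun y => partials f y k) x (EuclideanSpace.single i 1))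
        (fun i k => fderiv ℝ (fun y => partials v y k) x (EuclideanSpace.single i 1))
        (fun i k => partials_partials_symm (hf.contDiffAt hn) i k)
        (fun i k => partials_partials_symm (hv.contDiffAt hn) i k)]
      refine Finset.sum_congr rfl fun i _ => Finset.sum_congr rfl fun j _ => ?_
      rw [(hXU i j x hx).fderiv_eq]
      by_cases hij : i = j
      · simp [hij]
      · simp only [hij, if_false]
        exact fderiv_alternating_fluxTuple α (hf.contDiffAt hn) (hu.contDiffAt hn)
          (hv.contDiffAt hn) hij
    · rw [Set.indicator_of_notMem hx]
      refine Finset.sum_eq_zero fun i _ => Finset.sum_eq_zero fun j _ => ?_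
      rw [(hXK i j x fun h => hx (hKU h)).fderiv_eq]
      have : fderiv ℝ (0 : EuclideanSpace ℝ (Fin n) → ℝ) x = 0 := fderiv_const_apply (0 : ℝ)
      rw [this, zero_apply]
  rw [← integral_indicator hU.measurableSet]
  simp_rw [← hdiv]
  have hint : ∀ i j, Integrable fun x => fderiv ℝ (X i j) x (EuclideanSpace.single i 1) :=
    fun i j => (((hXd i j).continuous_fderiv (by simp)).clm_apply
      continuous_const).integrable_of_hasCompactSupport
      (((hXs i j).fderiv ℝ).mono' (fun x hx => by
        by_contra h
        exact hx (by simp [image_eq_zero_of_notMem_tsupport h])))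
  rw [integral_finsetSum _ fun i _ => integrable_finsetSum _ fun j _ => hint i j]
  refine Finset.sum_eq_zero fun i _ => ?_
  rw [integral_finsetSum _ fun j _ => hint i j]
  exact Finset.sum_eq_zero fun j _ => integral_fderiv_apply_eq_zero (hXd i j) (hXs i j) _

end IntegrationByParts

/-! ### The Riemannian volume measure -/

section Volume

open MeasureTheory

section

variable {n d : ℕ} {M : Type*} [TopologicalSpace M] [MeasurableSpace M]

/-- The measure `√(det g_{ij}) dx¹⋯dxⁿ` carried by the domain of `c`. -/
def chartVolume (F : M → EuclideanSpace ℝ (Fin d))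
    (c : OpenPartialHomeomorph M (EuclideanSpace ℝ (Fin n))) : Measure M :=
  Measure.map c.symm ((volume.restrict c.target).withDensity
    (fun x => ENNReal.ofReal (volDensity F c x)))

variable [BorelSpace M]

lemma aemeasurable_symm (c : OpenPartialHomeomorph M (EuclideanSpace ℝ (Fin n)))
    (ρ : EuclideanSpace ℝ (Fin n) → ENNReal) :
    AEMeasurable c.symm ((volume.restrict c.target).withDensity ρ) :=
  (c.continuousOn_symm.aemeasurable c.open_target.measurableSet).mono_ac
    (withDensity_absolutelyContinuous _ _)

lemma measurableSet_preimage_symm_inter (c : OpenPartialHomeomorph M (EuclideanSpace ℝ (Fin n)))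
    {S : Set M} (hS : MeasurableSet S) : MeasurableSet (c.symm ⁻¹' S ∩ c.target) := by
  have h1 : Measurable fun x : c.target => c.symm x :=
    (continuousOn_iff_continuous_domRestrict.1 c.continuousOn_symm).measurable
  have h2 := c.open_target.measurableSet.subtype_image (h1 hS)
  convert h2 using 1
  ext x
  simp [and_comm]

lemma chartVolume_apply (F : M → EuclideanSpace ℝ (Fin d))
    (c : OpenPartialHomeomorph M (EuclideanSpace ℝ (Fin n))) {S : Set M} (hS : MeasurableSet S) :
    chartVolume F c S = ∫⁻ x in c.symm ⁻¹' S ∩ c.target, ENNReal.ofReal (volDensity F c x) := by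
  rw [chartVolume, Measure.map_apply_of_aemeasurable (aemeasurable_symm c _) hS,
    withDensity_apply', Measure.restrict_restrict' c.open_target.measurableSet]

lemma chartVolume_compl_source (F : M → EuclideanSpace ℝ (Fin d))
    (c : OpenPartialHomeomorph M (EuclideanSpace ℝ (Fin n))) {S : Set M} (hS : MeasurableSet S)
    (h : Disjoint S c.source) : chartVolume F c S = 0 := by
  rw [chartVolume_apply F c hS]
  have : c.symm ⁻¹' S ∩ c.target = ∅ := by
    ext x
    simp only [Set.mem_inter_iff, Set.mem_preimage, Set.mem_empty_iff_false, iff_false, not_and]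
    intro hx hx'
    exact Set.disjoint_left.1 h hx (c.map_target hx')
  rw [this]
  simp

end

variable {n d : ℕ} {M : Type*} [TopologicalSpace M] [ChartedSpace (EuclideanSpace ℝ (Fin n)) M]
  {F : M → EuclideanSpace ℝ (Fin d)}

section

variable [IsManifold (𝓡 n) ∞ M]

lemma continuousOn_chartFrame {G : M → EuclideanSpace ℝ (Fin d)}
    (hG : ContMDiff (𝓡 n) 𝓘(ℝ, EuclideanSpace ℝ (Fin d)) ∞ G)
    {c : OpenPartialHomeomorph M (EuclideanSpace ℝ (Fin n))}
    (hc : c ∈ atlas (EuclideanSpace ℝ (Fin n)) M) : ContinuousOn (chartFrame G c) c.target := by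
  intro x hx
  refine ContinuousAt.continuousWithinAt (continuousAt_pi.2 fun i => ?_)
  exact (contDiffAt_partials ((contDiffOn_comp_symm hG hc).contDiffAt
    (c.open_target.mem_nhds hx)) i).continuousAt

lemma continuousOn_volDensity (hF : ContMDiff (𝓡 n) 𝓘(ℝ, EuclideanSpace ℝ (Fin d)) ∞ F)
    {c : OpenPartialHomeomorph M (EuclideanSpace ℝ (Fin n))}
    (hc : c ∈ atlas (EuclideanSpace ℝ (Fin n)) M) : ContinuousOn (volDensity F c) c.target := by
  have h1 : Continuous fun a : Fin n → EuclideanSpace ℝ (Fin d) => √(gramMat a a).det :=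
    ((continuous_gramMat.comp (continuous_id.prodMk continuous_id)).matrix_det).sqrt
  exact h1.comp_continuousOn (continuousOn_chartFrame hF hc)

lemma volDensity_eq (hF : ContMDiff (𝓡 n) 𝓘(ℝ, EuclideanSpace ℝ (Fin d)) ∞ F)
    {c c' : OpenPartialHomeomorph M (EuclideanSpace ℝ (Fin n))}
    (hc : c ∈ atlas (EuclideanSpace ℝ (Fin n)) M) (hc' : c' ∈ atlas (EuclideanSpace ℝ (Fin n)) M)
    {x : EuclideanSpace ℝ (Fin n)} (hx : x ∈ (c.symm.trans c').source) :
    volDensity F c x =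
      |(fderiv ℝ (fun y => c' (c.symm y)) x).det| * volDensity F c' (c' (c.symm x)) := by
  change √(gramMat (chartFrame F c x) (chartFrame F c x)).det = _ *
    √(gramMat (chartFrame F c' (c' (c.symm x))) (chartFrame F c' (c' (c.symm x)))).det
  rw [chartFrame_eq_comb hF hc hc' hx, sqrt_det_gramMat_comb, det_jac]

end

variable [MeasurableSpace M]

lemma riemannianVolume_eq_iSup (F : M → EuclideanSpace ℝ (Fin d)) :
    riemannianVolume n F = ⨆ c ∈ atlas (EuclideanSpace ℝ (Fin n)) M, chartVolume F c := rfl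

lemma chartVolume_le (F : M → EuclideanSpace ℝ (Fin d))
    {c : OpenPartialHomeomorph M (EuclideanSpace ℝ (Fin n))}
    (hc : c ∈ atlas (EuclideanSpace ℝ (Fin n)) M) : chartVolume F c ≤ riemannianVolume n F :=
  le_iSup₂ (f := fun c (_ : c ∈ atlas (EuclideanSpace ℝ (Fin n)) M) => chartVolume F c) c hc

variable [BorelSpace M]

variable [IsManifold (𝓡 n) ∞ M]

/-- Change of variables along the transition map, whose Jacobian determinant is exactly the ratio of
the two volume densities. -/
lemma chartVolume_eq_of_subset (hF : ContMDiff (𝓡 n) 𝓘(ℝ, EuclideanSpace ℝ (Fin d)) ∞ F)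
    {c c' : OpenPartialHomeomorph M (EuclideanSpace ℝ (Fin n))}
    (hc : c ∈ atlas (EuclideanSpace ℝ (Fin n)) M) (hc' : c' ∈ atlas (EuclideanSpace ℝ (Fin n)) M)
    {S : Set M} (hS : MeasurableSet S) (h : S ⊆ c.source) (h' : S ⊆ c'.source) :
    chartVolume F c' S = chartVolume F c S := by
  rw [chartVolume_apply F c hS, chartVolume_apply F c' hS]
  set A := c.symm ⁻¹' S ∩ c.target with hA
  have hsub : A ⊆ (c.symm.trans c').source := by
    rintro x ⟨hx, hx'⟩
    simpa [hx'] using h' hx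
  have himg : c'.symm ⁻¹' S ∩ c'.target = (fun y => c' (c.symm y)) '' A := by
    ext z
    constructor
    · rintro ⟨hz, hz'⟩
      refine ⟨c (c'.symm z), ⟨?_, c.map_source (h hz)⟩, ?_⟩
      · simpa [c.left_inv (h hz)] using hz
      · simp [c.left_inv (h hz), c'.right_inv hz']
    · rintro ⟨x, ⟨hx, hx'⟩, rfl⟩
      refine ⟨?_, c'.map_source (h' hx)⟩
      simpa [c'.left_inv (h' hx)] using hx
  have hinj : Set.InjOn (fun y => c' (c.symm y)) A := fun x hx y hy hxy =>
    (c.symm.trans c').injOn (hsub hx) (hsub hy) hxy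
  have hder : ∀ x ∈ A, HasFDerivWithinAt (fun y => c' (c.symm y))
      (fderiv ℝ (fun y => c' (c.symm y)) x) A x := fun x hx =>
    (((contDiffOn_transition hc hc').contDiffAt ((c.symm.trans c').open_source.mem_nhds
      (hsub hx))).differentiableAt (by simp)).hasFDerivAt.hasFDerivWithinAt
  have hAm : MeasurableSet A := measurableSet_preimage_symm_inter c hS
  rw [himg, lintegral_image_eq_lintegral_abs_det_fderiv_mul volume hAm hder hinj]
  refine setLIntegral_congr_fun hAm fun x hx => ?_
  beta_reduce
  rw [← ENNReal.ofReal_mul (abs_nonneg _), ← volDensity_eq hF hc hc' (hsub hx)]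

lemma riemannianVolume_apply (hF : ContMDiff (𝓡 n) 𝓘(ℝ, EuclideanSpace ℝ (Fin d)) ∞ F)
    {c : OpenPartialHomeomorph M (EuclideanSpace ℝ (Fin n))}
    (hc : c ∈ atlas (EuclideanSpace ℝ (Fin n)) M) {S : Set M} (hS : MeasurableSet S)
    (h : S ⊆ c.source) : riemannianVolume n F S = chartVolume F c S := by
  refine le_antisymm ?_ (chartVolume_le F hc S)
  have hs := c.open_source.measurableSet
  -- The right-hand side dominates every chart measure, hence their supremum: inside `c.source`
  -- chart measures agree on overlaps, and outside it the supremum itself is the bound.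
  have key : riemannianVolume n F ≤
      chartVolume F c + (riemannianVolume n F).restrict c.sourceᶜ := by
    conv_lhs => rw [riemannianVolume_eq_iSup]
    refine iSup₂_le fun c' hc' => Measure.le_iff.2 fun T hT => ?_
    rw [Measure.add_apply, Measure.restrict_apply hT, ← measure_inter_add_sdiff T hs]
    refine add_le_add ?_ (chartVolume_le F hc' _)
    rw [← measure_inter_add_sdiff (T ∩ c.source) c'.open_source.measurableSet]
    have h0 : chartVolume F c' ((T ∩ c.source) \ c'.source) = 0 :=
      chartVolume_compl_source F c' ((hT.inter hs).diff c'.open_source.measurableSet)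
        Set.disjoint_sdiff_left
    rw [h0, add_zero, chartVolume_eq_of_subset hF hc hc'
      ((hT.inter hs).inter c'.open_source.measurableSet)
      (Set.inter_subset_left.trans Set.inter_subset_right) Set.inter_subset_right]
    exact measure_mono (Set.inter_subset_left.trans Set.inter_subset_left)
  have h1 := key S
  rw [Measure.add_apply, Measure.restrict_apply hS,
    (Set.disjoint_compl_right_iff_subset.2 h).inter_eq] at h1
  simpa using h1

lemma riemannianVolume_restrict (hF : ContMDiff (𝓡 n) 𝓘(ℝ, EuclideanSpace ℝ (Fin d)) ∞ F)
    {c : OpenPartialHomeomorph M (EuclideanSpace ℝ (Fin n))}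
    (hc : c ∈ atlas (EuclideanSpace ℝ (Fin n)) M) :
    (riemannianVolume n F).restrict c.source = chartVolume F c := by
  ext S hS
  have hs := c.open_source.measurableSet
  rw [Measure.restrict_apply hS, riemannianVolume_apply hF hc (hS.inter hs) Set.inter_subset_right,
    ← measure_inter_add_sdiff S hs (μ := chartVolume F c),
    chartVolume_compl_source F c (hS.diff hs) Set.disjoint_sdiff_left, add_zero]

/-- The integral of a function supported in the domain of a chart. -/
lemma integral_riemannianVolume (hF : ContMDiff (𝓡 n) 𝓘(ℝ, EuclideanSpace ℝ (Fin d)) ∞ F)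
    {c : OpenPartialHomeomorph M (EuclideanSpace ℝ (Fin n))}
    (hc : c ∈ atlas (EuclideanSpace ℝ (Fin n)) M) {f : M → ℝ} (hf : Continuous f)
    (hfc : ∀ p, p ∉ c.source → f p = 0) :
    ∫ p, f p ∂(riemannianVolume n F) =
      ∫ x in c.target, volDensity F c x * f (c.symm x) := by
  rw [← setIntegral_eq_integral_of_forall_compl_eq_zero hfc, riemannianVolume_restrict hF hc,
    chartVolume, integral_map (aemeasurable_symm c _) hf.measurable.aestronglyMeasurable,
    integral_withDensity_eq_integral_toReal_smul₀]
  · refine integral_congr_ae (Filter.Eventually.of_forall fun x => ?_)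
    simp [ENNReal.toReal_ofReal (Real.sqrt_nonneg _), volDensity]
  · exact ((continuousOn_volDensity hF hc).aemeasurable
      c.open_target.measurableSet).ennreal_ofReal
  · exact Filter.Eventually.of_forall fun x => ENNReal.ofReal_lt_top

/-- The volume density is continuous, hence bounded near each point. Local finiteness is what makes
continuous compactly supported densities integrable. -/
lemma isLocallyFiniteMeasure_riemannianVolume
    (hF : ContMDiff (𝓡 n) 𝓘(ℝ, EuclideanSpace ℝ (Fin d)) ∞ F) :
    IsLocallyFiniteMeasure (riemannianVolume n F) := by
  refine ⟨fun p => ?_⟩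
  set c := chartAt (EuclideanSpace ℝ (Fin n)) p
  have hc : c ∈ atlas (EuclideanSpace ℝ (Fin n)) M := chart_mem_atlas _ p
  have hp : c p ∈ c.target := mem_chart_target _ p
  have hcont : ContinuousAt (volDensity F c) (c p) :=
    (continuousOn_volDensity hF hc).continuousAt (c.open_target.mem_nhds hp)
  set C := volDensity F c (c p) + 1
  have hev : ∀ᶠ x in nhds (c p), volDensity F c x < C ∧ x ∈ Metric.ball (c p) 1 :=
    (hcont.eventually (gt_mem_nhds (lt_add_one _))).and (Metric.ball_mem_nhds _ one_pos)
  obtain ⟨O, hO, hOo, hpO⟩ := eventually_nhds_iff.1 hev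
  have hso : IsOpen (c.source ∩ c ⁻¹' O) := c.isOpen_inter_preimage hOo
  refine ⟨c.source ∩ c ⁻¹' O, hso.mem_nhds ⟨mem_chart_source _ p, hpO⟩, ?_⟩
  rw [riemannianVolume_apply hF hc hso.measurableSet Set.inter_subset_left,
    chartVolume_apply F c hso.measurableSet]
  have hsub : c.symm ⁻¹' (c.source ∩ c ⁻¹' O) ∩ c.target ⊆ O := by
    rintro x ⟨⟨-, hx⟩, hx'⟩
    simpa [c.right_inv hx'] using hx
  calc ∫⁻ x in c.symm ⁻¹' (c.source ∩ c ⁻¹' O) ∩ c.target, ENNReal.ofReal (volDensity F c x)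
      ≤ ∫⁻ x in O, ENNReal.ofReal (volDensity F c x) := lintegral_mono_set hsub
    _ ≤ ∫⁻ x in O, ENNReal.ofReal C := by
        refine setLIntegral_mono measurable_const fun x hx => ?_
        exact ENNReal.ofReal_le_ofReal (hO x hx).1.le
    _ = ENNReal.ofReal C * volume O := setLIntegral_const _ _
    _ ≤ ENNReal.ofReal C * volume (Metric.ball (c p) 1) := by
        gcongr
        exact fun x hx => (hO x hx).2
    _ < ⊤ := ENNReal.mul_lt_top ENNReal.ofReal_lt_top measure_ball_lt_top

end Volume

/-! ### Vanishing of the integrated second variation -/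

section SecondVariation

open MeasureTheory

variable {n d : ℕ} {M : Type*} [TopologicalSpace M] [ChartedSpace (EuclideanSpace ℝ (Fin n)) M]
  {F V W : M → EuclideanSpace ℝ (Fin d)}

lemma coordFrame_eq_zero {p : M} (hp : p ∉ tsupport V) : coordFrame n V p = 0 := by
  have h : V =ᶠ[nhds p] fun _ => 0 := notMem_tsupport_iff_eventuallyEq.1 hp
  have h2 : D (n := n) V p = D (fun _ : M => (0 : EuclideanSpace ℝ (Fin d))) p := h.mfderiv_eq
  have h3 : D (n := n) (fun _ : M => (0 : EuclideanSpace ℝ (Fin d))) p = 0 := mfderiv_const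
  ext1 i
  simp only [coordFrame, h2, h3]
  rfl

lemma mixedSum_zero_left {E : Type*} [NormedAddCommGroup E] [InnerProductSpace ℝ E]
    (α : E [⋀^Fin n]→L[ℝ] ℝ) (a w : Fin n → E) : mixedSum α a 0 w = 0 := by
  refine Finset.sum_eq_zero fun i _ => Finset.sum_eq_zero fun j _ => ?_
  by_cases hij : i = j
  · simp [hij]
  · rw [if_neg hij]
    exact α.map_coord_zero i (by simp [hij])

lemma gramMat_zero_left {E : Type*} [NormedAddCommGroup E] [InnerProductSpace ℝ E]
    (a : Fin n → E) : gramMat 0 a = 0 := by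
  ext i j; simp [gramMat]

lemma IsParallelForm.exists_eq_const
    {Ω : EuclideanSpace ℝ (Fin d) → EuclideanSpace ℝ (Fin d) [⋀^Fin n]→L[ℝ] ℝ}
    (h : IsParallelForm Ω) : ∃ α, Ω = fun _ => α :=
  ⟨Ω 0, funext fun y => is_const_of_fderiv_eq_zero (𝕜 := ℝ)
    (fun z => (h z).differentiableAt) (fun z => (h z).fderiv) y 0⟩

lemma hasCompactSupport_mixedDensity [T2Space M] (hc : HasCompactSupport V)
    (α : EuclideanSpace ℝ (Fin d) [⋀^Fin n]→L[ℝ] ℝ) :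
    HasCompactSupport fun p =>
      mixedDensity α (coordFrame n F p) (coordFrame n V p) (coordFrame n W p) :=
  HasCompactSupport.intro hc fun p hp => by
    rw [coordFrame_eq_zero hp, mixedDensity, mixedSum_zero_left, mul_zero]

lemma hasCompactSupport_energyDensity [T2Space M] (hc : HasCompactSupport V)
    (α : EuclideanSpace ℝ (Fin d) [⋀^Fin n]→L[ℝ] ℝ) :
    HasCompactSupport fun p => unitValue α (coordFrame n F p) *
      (normalEnergy (coordFrame n F p) (coordFrame n V p) -
        tangentEnergy (coordFrame n F p) (coordFrame n V p)) :=
  HasCompactSupport.intro hc fun p hp => by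
    rw [coordFrame_eq_zero hp, normalEnergy, tangentEnergy, gramMat_zero_left, gramMat_zero_left,
      doubleTrace]
    simp

variable [IsManifold (𝓡 n) ∞ M]

/-- A function of the first derivatives of `F`, `V`, `W` that does not depend on the choice of
oriented coordinates is continuous. -/
lemma continuous_of_comb_invariant (horient : OrientedAtlas n M) (hF : IsSmoothImmersion n F)
    (hV : ContMDiff (𝓡 n) 𝓘(ℝ, EuclideanSpace ℝ (Fin d)) ∞ V)
    (hW : ContMDiff (𝓡 n) 𝓘(ℝ, EuclideanSpace ℝ (Fin d)) ∞ W)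
    {Ψ : (Fin n → EuclideanSpace ℝ (Fin d)) → (Fin n → EuclideanSpace ℝ (Fin d)) →
      (Fin n → EuclideanSpace ℝ (Fin d)) → ℝ}
    (hinv : ∀ (P : Matrix (Fin n) (Fin n) ℝ), 0 < P.det → ∀ a v w,
      Ψ (comb P a) (comb P v) (comb P w) = Ψ a v w)
    (hcont : ∀ a v w, LinearIndependent ℝ a → ContinuousAt
      (fun q : (Fin n → EuclideanSpace ℝ (Fin d)) × (Fin n → EuclideanSpace ℝ (Fin d)) ×
        (Fin n → EuclideanSpace ℝ (Fin d)) => Ψ q.1 q.2.1 q.2.2) (a, v, w)) :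
    Continuous fun p => Ψ (coordFrame n F p) (coordFrame n V p) (coordFrame n W p) := by
  rw [continuous_iff_continuousAt]
  intro p
  set c := chartAt (EuclideanSpace ℝ (Fin n)) p with hcdef
  have hc : c ∈ atlas (EuclideanSpace ℝ (Fin n)) M := chart_mem_atlas _ p
  have hcp : ContinuousAt c p := c.continuousAt (mem_chart_source _ p)
  have hfr : ∀ {G : M → EuclideanSpace ℝ (Fin d)},
      ContMDiff (𝓡 n) 𝓘(ℝ, EuclideanSpace ℝ (Fin d)) ∞ G →
        ContinuousAt (fun q => chartFrame G c (c q)) p := fun hG =>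
    ContinuousAt.comp (g := chartFrame _ c) ((continuousOn_chartFrame hG hc).continuousAt
      (c.open_target.mem_nhds (mem_chart_target _ p))) hcp
  -- The frame from the preferred chart at `q` may jump with `q`; invariance replaces it by the
  -- frame of the one chart at `p`, which is continuous.
  have hev : (fun q => Ψ (coordFrame n F q) (coordFrame n V q) (coordFrame n W q)) =ᶠ[nhds p]
      fun q => Ψ (chartFrame F c (c q)) (chartFrame V c (c q)) (chartFrame W c (c q)) := by
    filter_upwards [c.open_source.mem_nhds (mem_chart_source _ p)] with q hq
    obtain ⟨P, hP, h⟩ :=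
      exists_chartFrame_eq_comb_coordFrame (d := d) horient hc (c.map_source hq)
    rw [h hF.smooth, h hV, h hW, hinv P hP, c.left_inv hq]
  refine ContinuousAt.congr ?_ hev.symm
  have hli : LinearIndependent ℝ (chartFrame F c (c p)) := by
    rw [hcdef, ← coordFrame_eq_chartFrame hF.smooth p]
    exact linearIndependent_coordFrame (hF.injective p)
  exact (hcont _ (chartFrame V c (c p)) (chartFrame W c (c p)) hli).comp
    (f := fun q => (chartFrame F c (c q), chartFrame V c (c q), chartFrame W c (c q)))
    ((hfr hF.smooth).prodMk ((hfr hV).prodMk (hfr hW)))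

lemma continuous_mixedDensity (horient : OrientedAtlas n M) (hF : IsSmoothImmersion n F)
    (hV : ContMDiff (𝓡 n) 𝓘(ℝ, EuclideanSpace ℝ (Fin d)) ∞ V)
    (hW : ContMDiff (𝓡 n) 𝓘(ℝ, EuclideanSpace ℝ (Fin d)) ∞ W)
    (α : EuclideanSpace ℝ (Fin d) [⋀^Fin n]→L[ℝ] ℝ) :
    Continuous fun p =>
      mixedDensity α (coordFrame n F p) (coordFrame n V p) (coordFrame n W p) :=
  continuous_of_comb_invariant horient hF hV hW (Ψ := mixedDensity α)
    (fun _ hP a v w => mixedDensity_comb α hP a v w)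
    (fun _ _ _ ha => continuousAt_mixedDensity α continuousAt_fst ha
      (continuousAt_fst.comp continuousAt_snd) (continuousAt_snd.comp continuousAt_snd))

lemma continuous_energyDensity (horient : OrientedAtlas n M) (hF : IsSmoothImmersion n F)
    (hV : ContMDiff (𝓡 n) 𝓘(ℝ, EuclideanSpace ℝ (Fin d)) ∞ V)
    (α : EuclideanSpace ℝ (Fin d) [⋀^Fin n]→L[ℝ] ℝ) :
    Continuous fun p => unitValue α (coordFrame n F p) *
      (normalEnergy (coordFrame n F p) (coordFrame n V p) -
        tangentEnergy (coordFrame n F p) (coordFrame n V p)) :=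
  continuous_of_comb_invariant horient hF hV hV
    (Ψ := fun a v _ => unitValue α a * (normalEnergy a v - tangentEnergy a v))
    (fun P hP a v w => by
      rw [unitValue_comb α hP, normalEnergy_comb hP.ne', tangentEnergy_comb hP.ne'])
    (fun a v w ha => by
      set x : (Fin n → EuclideanSpace ℝ (Fin d)) × (Fin n → EuclideanSpace ℝ (Fin d)) ×
        (Fin n → EuclideanSpace ℝ (Fin d)) := (a, v, w)
      have h1 : ContinuousAt Prod.fst x := continuousAt_fst
      have h2 : ContinuousAt (fun q : (Fin n → EuclideanSpace ℝ (Fin d)) ×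
          (Fin n → EuclideanSpace ℝ (Fin d)) × (Fin n → EuclideanSpace ℝ (Fin d)) => q.2.1) x :=
        continuousAt_fst.comp continuousAt_snd
      have hu := continuousAt_unitValue α h1 ha
      have hn := continuousAt_normalEnergy h1 ha h2
      have ht := continuousAt_tangentEnergy h1 ha h2
      exact hu.mul (hn.sub ht))

lemma coordFrame_sum {ι : Type*} (s : Finset ι) {G : ι → M → EuclideanSpace ℝ (Fin d)}
    (hG : ∀ k, ContMDiff (𝓡 n) 𝓘(ℝ, EuclideanSpace ℝ (Fin d)) ∞ (G k))
    (hV : ContMDiff (𝓡 n) 𝓘(ℝ, EuclideanSpace ℝ (Fin d)) ∞ V)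
    (h : ∀ p, V p = ∑ k ∈ s, G k p) (p : M) :
    coordFrame n V p = fun i => ∑ k ∈ s, coordFrame n (G k) p i := by
  ext1 i
  simp_rw [coordFrame_eq_chartFrame hV, coordFrame_eq_chartFrame (hG _), chartFrame, h]
  rw [fderiv_fun_sum fun k _ => (contDiffAt_chart (hG k) p).differentiableAt (by simp)]
  simp

variable [MeasurableSpace M] [BorelSpace M]

lemma integral_mixedDensity_eq_zero_of_chart [T2Space M] (horient : OrientedAtlas n M)
    (hF : IsSmoothImmersion n F)
    (hV : ContMDiff (𝓡 n) 𝓘(ℝ, EuclideanSpace ℝ (Fin d)) ∞ V)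
    (hW : ContMDiff (𝓡 n) 𝓘(ℝ, EuclideanSpace ℝ (Fin d)) ∞ W)
    (α : EuclideanSpace ℝ (Fin d) [⋀^Fin n]→L[ℝ] ℝ)
    {c : OpenPartialHomeomorph M (EuclideanSpace ℝ (Fin n))}
    (hc : c ∈ atlas (EuclideanSpace ℝ (Fin n)) M) (hVs : HasCompactSupport V)
    (hVc : tsupport V ⊆ c.source) :
    ∫ p, mixedDensity α (coordFrame n F p) (coordFrame n V p) (coordFrame n W p)
      ∂(riemannianVolume n F) = 0 := by
  rw [integral_riemannianVolume hF.smooth hc (continuous_mixedDensity horient hF hV hW α)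
    (fun p hp => by
      rw [coordFrame_eq_zero fun h => hp (hVc h), mixedDensity, mixedSum_zero_left, mul_zero])]
  -- The volume density cancels the normalising factor of `mixedDensity`, leaving the bare
  -- divergence for Lebesgue measure.
  have hcongr : ∀ x ∈ c.target, volDensity F c x * mixedDensity α (coordFrame n F (c.symm x))
      (coordFrame n V (c.symm x)) (coordFrame n W (c.symm x)) =
      mixedSum α (partials (fun y => F (c.symm y)) x) (partials (fun y => V (c.symm y)) x)
        (partials (fun y => W (c.symm y)) x) := by
    intro x hx
    obtain ⟨P, hP, h⟩ := exists_chartFrame_eq_comb_coordFrame (d := d) horient hc hx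
    rw [← mixedDensity_comb α hP, ← h hF.smooth, ← h hV, ← h hW]
    have hli : LinearIndependent ℝ (coordFrame n F (c.symm x)) :=
      linearIndependent_coordFrame (hF.injective _)
    have hpos : 0 < √(gramMat (chartFrame F c x) (chartFrame F c x)).det := by
      rw [h hF.smooth, sqrt_det_gramMat_comb]
      exact mul_pos (abs_pos.2 hP.ne') (Real.sqrt_pos.2 (det_gramMat_pos hli))
    exact mul_inv_cancel_left₀ hpos.ne' _
  rw [setIntegral_congr_fun c.open_target.measurableSet hcongr]
  refine setIntegral_mixedSum_eq_zero α (K := c '' tsupport V) c.open_target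
    (hVs.image_of_continuousOn (c.continuousOn.mono hVc)) ?_ (contDiffOn_comp_symm hF.smooth hc)
    (contDiffOn_comp_symm hV hc) (contDiffOn_comp_symm hW hc) ?_
  · rintro _ ⟨p, hp, rfl⟩
    exact c.map_source (hVc hp)
  · intro x hx hxK
    by_contra h
    exact hxK ⟨c.symm x, subset_tsupport _ h, c.right_inv hx⟩

/-- The second variation of `∫ F_s^*Ω` vanishes for a compactly supported variation and a
constant form. -/
lemma integral_mixedDensity_eq_zero [T2Space M] [SecondCountableTopology M]
    (horient : OrientedAtlas n M) (hF : IsSmoothImmersion n F)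
    (hV : ContMDiff (𝓡 n) 𝓘(ℝ, EuclideanSpace ℝ (Fin d)) ∞ V)
    (hW : ContMDiff (𝓡 n) 𝓘(ℝ, EuclideanSpace ℝ (Fin d)) ∞ W)
    (hVs : HasCompactSupport V)
    (α : EuclideanSpace ℝ (Fin d) [⋀^Fin n]→L[ℝ] ℝ) :
    ∫ p, mixedDensity α (coordFrame n F p) (coordFrame n V p) (coordFrame n W p)
      ∂(riemannianVolume n F) = 0 := by
  have : LocallyCompactSpace M := ChartedSpace.locallyCompactSpace (EuclideanSpace ℝ (Fin n)) M
  have := isLocallyFiniteMeasure_riemannianVolume hF.smooth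
  obtain ⟨ρ, hρ⟩ := SmoothPartitionOfUnity.exists_isSubordinate_chartAt_source (𝓡 n) M
  have hfin := ρ.locallyFinite.finite_nonempty_inter_compact hVs
  set s := hfin.toFinset with hs
  set G : M → M → EuclideanSpace ℝ (Fin d) := fun k p => ρ k p • V p with hG
  have hGsm : ∀ k, ContMDiff (𝓡 n) 𝓘(ℝ, EuclideanSpace ℝ (Fin d)) ∞ (G k) :=
    fun k => (ρ k).contMDiff.smul hV
  have hGs : ∀ k, tsupport (G k) ⊆ tsupport V := fun k => by
    refine closure_mono fun p hp => ?_
    exact fun h => hp (by simp [hG, h])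
  have hGc : ∀ k, tsupport (G k) ⊆ (chartAt (EuclideanSpace ℝ (Fin n)) k).source := fun k => by
    refine (closure_mono fun p hp => ?_).trans (hρ k)
    exact fun h => hp (by simp [hG, h])
  have hGcs : ∀ k, HasCompactSupport (G k) := fun k =>
    hVs.of_isClosed_subset (isClosed_tsupport _) (hGs k)
  have hsum : ∀ p, V p = ∑ k ∈ s, G k p := by
    intro p
    by_cases hp : p ∈ tsupport V
    · have hsub : ρ.finsupport p ⊆ s := by
        intro k hk
        rw [hs, Set.Finite.mem_toFinset]
        exact ⟨p, (ρ.mem_finsupport p).1 hk, hp⟩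
      rw [← Finset.sum_smul, ρ.sum_finsupport' p (Set.mem_univ p) hsub, one_smul]
    · simp [hG, image_eq_zero_of_notMem_tsupport hp]
  -- Only `V` is localised while `W` stays whole, so linearity in a single slot suffices and no
  -- cross terms between different charts arise.
  have hdecomp : ∀ p, mixedDensity α (coordFrame n F p) (coordFrame n V p) (coordFrame n W p) =
      ∑ k ∈ s, mixedDensity α (coordFrame n F p) (coordFrame n (G k) p) (coordFrame n W p) := by
    intro p
    rw [coordFrame_sum s hGsm hV hsum]
    unfold mixedDensity
    rw [mixedSum_sum_left s α _ (fun k => coordFrame n (G k) p), Finset.mul_sum]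
  simp_rw [hdecomp]
  rw [integral_finsetSum _ fun k _ =>
    (continuous_mixedDensity horient hF (hGsm k) hW α).integrable_of_hasCompactSupport
      (hasCompactSupport_mixedDensity (hGcs k) α)]
  exact Finset.sum_eq_zero fun k _ => integral_mixedDensity_eq_zero_of_chart horient hF (hGsm k) hW
    α (chart_mem_atlas _ k) (hGcs k) (hGc k)

end SecondVariation
end CalibratedVariation

end

/-! ### The proposition -/

open CalibratedVariation in
theorem proposition2p1 {n m : ℕ}
    {M : Type*} [TopologicalSpace M] [T2Space M] [SecondCountableTopology M]
    [ChartedSpace (EuclideanSpace ℝ (Fin n)) M] [IsManifold (𝓡 n) ∞ M]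
    [MeasurableSpace M] [BorelSpace M]
    (horient : OrientedAtlas n M)
    (F : M → EuclideanSpace ℝ (Fin (n + m)))
    (hF : IsSmoothImmersion n F) (hmin : IsMinimal n F)
    (Ω : EuclideanSpace ℝ (Fin (n + m)) →
      EuclideanSpace ℝ (Fin (n + m)) [⋀^Fin n]→L[ℝ] ℝ)
    (hexact : IsExactForm Ω) (hparallel : IsParallelForm Ω)
    (ε : ℝ) (Φ : ℝ → M → EuclideanSpace ℝ (Fin (n + m)))
    (V : M → EuclideanSpace ℝ (Fin (n + m)))
    (hV : IsNormalVariation n F ε Φ V)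
    (hVV : ∀ p : M, iteratedDerivWithin 2 (fun s => Φ s p) (Set.Ico 0 ε) 0 = 0)
    (e : ∀ p : M, Fin n → TangentSpace (𝓡 n) p)
    (he : IsOrientedOrthonormalFrame F e) :
    let lhs : M → ℝ := fun p =>
      hodgeStar Ω F p * (normSqNormalDeriv n F V p - B n F V p)
    let T : ∀ _ : M, Fin n → EuclideanSpace ℝ (Fin (n + m)) :=
      fun p i => tanPart (n := n) F p (D V p (e p i))
    let N : ∀ _ : M, Fin n → EuclideanSpace ℝ (Fin (n + m)) :=
      fun p i => norPart (n := n) F p (D V p (e p i))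
    let rhs : M → ℝ := fun p =>
      hodgeStar Ω F p * normSqNormalDeriv n F V p
        - 2 * pairSum Ω F p (e p) (T p) (N p)
        - 2 * pairSum Ω F p (e p) (N p) (N p)
        - 2 * pairSum Ω F p (e p) (N p) (T p)
    MeasureTheory.Integrable lhs (riemannianVolume n F) ∧
      MeasureTheory.Integrable rhs (riemannianVolume n F) ∧
      ∫ p, lhs p ∂(riemannianVolume n F) = ∫ p, rhs p ∂(riemannianVolume n F) := by
  intro lhs T N rhs
  obtain ⟨α, rfl⟩ := hparallel.exists_eq_const
  have hVs := hV.contMDiff_field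
  have hc := hV.compactSupport
  have := isLocallyFiniteMeasure_riemannianVolume hF.smooth
  have hl : lhs = fun p => unitValue α (coordFrame n F p) *
      (normalEnergy (coordFrame n F p) (coordFrame n V p) -
        tangentEnergy (coordFrame n F p) (coordFrame n V p)) := by
    funext p
    simp only [lhs, hodgeStar_eq, normSqNormalDeriv_eq (hF.injective p),
      B_eq hF.smooth hVs hV.normal]
  -- The frame `e` need not even be measurable; integrability of the right-hand side comes from this
  -- frame-free expression.
  have hr : rhs = fun p => lhs p -
      mixedDensity α (coordFrame n F p) (coordFrame n V p) (coordFrame n V p) := by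
    funext p
    exact integrand_eq hF hVs hV.normal hmin (fun _ => α) he p
  have hli : MeasureTheory.Integrable lhs (riemannianVolume n F) := by
    rw [hl]
    exact (continuous_energyDensity horient hF hVs α).integrable_of_hasCompactSupport
      (hasCompactSupport_energyDensity hc α)
  have hmi : MeasureTheory.Integrable (fun p => mixedDensity α (coordFrame n F p)
      (coordFrame n V p) (coordFrame n V p)) (riemannianVolume n F) :=
    (continuous_mixedDensity horient hF hVs hVs α).integrable_of_hasCompactSupport
      (hasCompactSupport_mixedDensity hc α)
  refine ⟨hli, ?_, ?_⟩
  · rw [hr]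
    exact hli.sub hmi
  · rw [hr, MeasureTheory.integral_sub hli hmi,
      integral_mixedDensity_eq_zero horient hF hVs hVs hc α, sub_zero]
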